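/- Let $d,q$ be integers with $d=1$ and $q\ge 3$, or with $d\ge 2$ and $q\ge 4$. Write $|\cdot|$ for the $1$-norm on $\mathbb Z^d$, and put $\mathrm{tower}(n)=\exp(\exp(\cdots\exp(1)))$ ($n$ exponentials) for integers $n\ge 0$, and $\mathrm{tower}(x)=\mathrm{tower}(\lfloor x\rfloor)$ for real $x\ge 0$. A $q$-coloring of $\mathbb Z^d$ is a random element $X=(X_v)_{v\in\mathbb Z^d}$ of $\{1,\dots,q\}^{\mathbb Z^d}$ such that almost surely $X_u\ne X_v$ whenever $|u-v|=1$. It is ffiid (a finitary factor of an iid process) if almost surely $X=F(Y)$ for some iid family $Y=(Y_v)_{v\in\mathbb Z^d}$ of random variables, with values in some measurable space, and some measurable map $F$ that commutes with all translations of $\mathbb Z^d$, such that for almost every $y$ with respect to the law of $Y$ there is an integer $r\ge 0$ with the property that $F(y')_0=F(y)_0$ for every $y'$ that agrees with $y$ on $\{v:|v|\le r\}$. The least such $r$ is denoted $R(y)$ (and $R(y)=\infty$ if there is none), and $R=R(Y)$ is the coding radius. There exist positive constants $c$ and $C$, depending only on $q$ and $d$, such that the following hold. (i) There exists an ffiid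 $q$-coloring of $\mathbb Z^d$ (indeed one with real-valued $Y_v$) whose coding radius satisfies $$\mathbb P(R>r)\le \frac{1}{\mathrm{tower}(cr)}\qquad\text{for all real } r\ge 0,$$ with strict inequality whenever $cr\ge 1$. (ii) Every ffiid $q$-coloring of $\mathbb Z^d$ (for every representation $X=F(Y)$ as above) satisfies $$\mathbb P(R>r)\ge \frac{1}{\mathrm{tower}(Cr)}\qquad\text{for all real } r\ge 0,$$ with strict inequality whenever $Cr\ge 1$. -/

import Mathlib

open MeasureTheory ProbabilityTheory

namespace FinitaryColoring

/-- The tower function on the natural numbers: `exp` iterated `n` times, applied to `1`. -/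
noncomputable def tower (n : ℕ) : ℝ := Real.exp^[n] 1

/-- The tower function of a nonnegative real number `x` is the tower function of `⌊x⌋`. -/
noncomputable def towerReal (x : ℝ) : ℝ := tower ⌊x⌋₊

/-- The sites of the lattice `ℤ^d`. -/
abbrev Site (d : ℕ) : Type := Fin d → ℤ

/-- The `1`-norm on `ℤ^d`. -/
def norm1 {d : ℕ} (v : Site d) : ℕ := ∑ i, (v i).natAbs

/-- The ball of radius `r` around the origin, in the `1`-norm. -/
def ball (d r : ℕ) : Set (Site d) := {v | norm1 v ≤ r}

/-- Translation of a configuration on `ℤ^d`. -/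
def translate {d : ℕ} {A : Type*} (u : Site d) (y : Site d → A) : Site d → A :=
  fun v => y (v - u)

/-- Factor maps: measurable maps (for the product σ-algebras) between configurations that
commute with every translation of `ℤ^d`. -/
structure IsFactorMap {d : ℕ} {B A : Type*} [MeasurableSpace B] [MeasurableSpace A]
    (F : (Site d → B) → (Site d → A)) : Prop where
  measurable : Measurable F
  equivariant : ∀ (u : Site d) (y : Site d → B), F (translate u y) = translate u (F y)

/-- The values of `y` on the ball of radius `r` determine the value of `F y` at the origin. -/
def Determines {d : ℕ} {B A : Type*} (F : (Site d → B) → (Site d → A)) (y : Site d → B)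
    (r : ℕ) : Prop :=
  ∀ y' : Site d → B, (∀ v ∈ ball d r, y' v = y v) → F y' 0 = F y 0

/-- The coding radius `R(y)`: the least `r` such that the values of `y` on the ball of radius `r`
determine the value of `F y` at the origin, and `⊤` if there is no such `r`. -/
noncomputable def codingRadius {d : ℕ} {B A : Type*} (F : (Site d → B) → (Site d → A))
    (y : Site d → B) : ℕ∞ :=
  ⨅ (r : ℕ) (_ : Determines F y r), (r : ℕ∞)

/-- The random configuration formed by the random variables `Y v`, `v ∈ ℤ^d`. -/
def config {d : ℕ} {Ω B : Type*} (Y : Site d → Ω → B) (ω : Ω) : Site d → B := fun v => Y v ω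

/-- `Y` is a family of independent, identically distributed random variables. -/
structure IsIID {d : ℕ} {Ω B : Type*} [MeasurableSpace Ω] [MeasurableSpace B]
    (P : Measure Ω) (Y : Site d → Ω → B) : Prop where
  measurable : ∀ v, Measurable (Y v)
  indep : iIndepFun Y P
  identDistrib : ∀ u v, IdentDistrib (Y u) (Y v) P P

/-- `X` is the finitary factor `F(Y)` of the iid process `Y`. -/
structure IsFFIID {d : ℕ} {Ω B A : Type*} [MeasurableSpace Ω] [MeasurableSpace B]
    [MeasurableSpace A] (P : Measure Ω) (Y : Site d → Ω → B)
    (F : (Site d → B) → (Site d → A)) (X : Ω → Site d → A) : Prop where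
  iid : IsIID P Y
  factor : IsFactorMap F
  eq_factor : ∀ᵐ ω ∂P, X ω = F (config Y ω)
  finitary : ∀ᵐ y ∂(P.map (config Y)), codingRadius F y ≠ ⊤

/-- `X` is a (random, proper) `q`-coloring of `ℤ^d`. -/
structure IsColoring {d q : ℕ} {Ω : Type*} [MeasurableSpace Ω] (P : Measure Ω)
    (X : Ω → Site d → Fin q) : Prop where
  measurable : Measurable X
  proper : ∀ᵐ ω ∂P, ∀ u v : Site d, norm1 (u - v) = 1 → X ω u ≠ X ω v

/-- The probability `P(R > r)`, for a real number `r ≥ 0`, where `R = R(Y)` is the coding radius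
of the factor `F(Y)`. -/
noncomputable def radiusTail {d : ℕ} {Ω B A : Type*} [MeasurableSpace Ω] (P : Measure Ω)
    (Y : Site d → Ω → B) (F : (Site d → B) → (Site d → A)) (r : ℝ) : ℝ :=
  P.real {ω | ENNReal.ofReal r < (codingRadius F (config Y ω) : ENNReal)}

end FinitaryColoring

universe u v

open FinitaryColoring

/-! Lower bound. Freezing the input outside the ball of radius `n` turns the coloring into a block
factor that sees `2 * n + 1` layers orthogonal to a coordinate direction, and that is wrong only
when the ball does not determine the color. A block factor with `q` colors cannot avoid repeating
its color at a neighbouring site (`inv_blockBound_le_measure_eq_shift`). Indeed, let `h` be the set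
of colors that are not too unlikely once the last layer is forgotten. It is a block factor with one
layer less and `2 ^ q` values, so by induction it often equals its own translate. The present color
then usually belongs to the set of the translate, and resampling one layer produces that color
again. Each layer costs one exponential in the number of colors, so the probability of a repetition
is at least the reciprocal of a tower of height linear in `n`. A proper coloring never repeats, so
the block factor errs at one of two neighbours.

Upper bound. Colors given by `size j` random bits, with `2 ^ size j` of tower size in `j`, clash
within a fixed neighbourhood with probability about `1 / tower j`. Where they do not clash, `j`
rounds of deterministic color reduction bring them down to boundedly many colors, because one round
replaces a palette by essentially its logarithm. A site takes the first level `j` at which it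
clashes with no neighbour, and a greedy algorithm treats the sites by level and then by reduced
color. This gives a maximal independent set that is determined within distance linear in `j` outside
an event of probability about `1 / tower j` (`Palettes.net_congr`, `Palettes.measure_not_fresh_le`).

A local rule then turns such a net into a coloring (`exists_radiusTail_le`). On the line, three
colors suffice because gaps have length 2 or 3. In general, two families of boxes around the net
points each cut the lattice into cells that carry a checkerboard parity. With well chosen radii no
edge is cut by both families, so the pair of parities is a proper 4-coloring. -/

namespace FinitaryColoring

open scoped ENNReal

/-! ### Resampling coordinates of a product measure -/

section Resampling

variable {ι B : Type*}

/-- The configuration that agrees with `y'` on `S` and with `y` off `S`. -/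
noncomputable def mix (S : Set ι) (y y' : ι → B) : ι → B :=
  open scoped Classical in fun i => if i ∈ S then y' i else y i

theorem mix_of_mem {S : Set ι} {y y' : ι → B} {i : ι} (h : i ∈ S) : mix S y y' i = y' i := by
  simp [mix, h]

theorem mix_of_notMem {S : Set ι} {y y' : ι → B} {i : ι} (h : i ∉ S) : mix S y y' i = y i := by
  simp [mix, h]

variable [MeasurableSpace B]

theorem measurable_mix (S : Set ι) :
    Measurable (fun p : (ι → B) × (ι → B) => mix S p.1 p.2) := by
  refine measurable_pi_lambda _ fun i => ?_
  by_cases h : i ∈ S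
  · simp only [mix_of_mem h]; fun_prop
  · simp only [mix_of_notMem h]; fun_prop

/-- Resampling the coordinates in `S` preserves a product measure. -/
theorem measurePreserving_mix (μ : Measure B) [IsProbabilityMeasure μ] (S : Set ι) :
    MeasurePreserving (fun p : (ι → B) × (ι → B) => mix S p.1 p.2)
      ((Measure.infinitePi fun _ : ι => μ).prod (Measure.infinitePi fun _ : ι => μ))
      (Measure.infinitePi fun _ : ι => μ) := by
  classical
  refine ⟨measurable_mix S, Measure.eq_infinitePi _ fun s t ht => ?_⟩
  rw [Measure.map_apply (measurable_mix S) (.pi s.countable_toSet fun _ _ => ht _)]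
  have : (fun p : (ι → B) × (ι → B) => mix S p.1 p.2) ⁻¹' ((s : Set ι).pi t) =
      (((s.filter (· ∉ S) : Finset ι) : Set ι).pi t) ×ˢ
        (((s.filter (· ∈ S) : Finset ι) : Set ι).pi t) := by
    ext ⟨y, y'⟩
    simp only [Set.mem_preimage, Set.mem_pi, Finset.mem_coe, Finset.coe_filter, Set.mem_prod,
      Set.mem_ofPred_eq]
    constructor
    · intro h
      exact ⟨fun i hi => by simpa [mix_of_notMem hi.2] using h i hi.1,
        fun i hi => by simpa [mix_of_mem hi.2] using h i hi.1⟩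
    · rintro ⟨h1, h2⟩ i hi
      by_cases hS : i ∈ S
      · simpa [mix_of_mem hS] using h2 i ⟨hi, hS⟩
      · simpa [mix_of_notMem hS] using h1 i ⟨hi, hS⟩
  rw [this, Measure.prod_prod, Measure.infinitePi_pi _ (fun i _ => ht i),
    Measure.infinitePi_pi _ (fun i _ => ht i), mul_comm, Finset.prod_filter_mul_prod_filter_not]

/-- Resampling a single coordinate preserves a product measure. -/
theorem measurePreserving_update [DecidableEq ι] (μ : Measure B) [IsProbabilityMeasure μ] (i : ι) :
    MeasurePreserving (fun p : (ι → B) × B => Function.update p.1 i p.2)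
      ((Measure.infinitePi fun _ : ι => μ).prod μ) (Measure.infinitePi fun _ : ι => μ) := by
  have hm : Measurable (fun p : (ι → B) × B => Function.update p.1 i p.2) := by
    refine measurable_pi_lambda _ fun j => ?_
    by_cases h : j = i
    · subst h; simpa using measurable_snd
    · simp only [Function.update_of_ne h]; fun_prop
  refine ⟨hm, ?_⟩
  have h1 := (MeasurePreserving.id (Measure.infinitePi fun _ : ι => μ)).prod
    (measurePreserving_eval_infinitePi (fun _ : ι => μ) i)
  rw [← h1.map_eq, Measure.map_map hm h1.measurable]
  refine Eq.trans ?_ (measurePreserving_mix μ {i}).map_eq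
  congr 1
  ext ⟨y, y'⟩ j
  by_cases h : j = i
  · subst h; simp [mix_of_mem]
  · simp [h, mix_of_notMem]

end Resampling

/-! ### Block factors repeat colors -/

section Block

variable {ι B : Type*} [MeasurableSpace B]

/-- The reciprocal of a lower bound for the probability that a block factor of range `n` with
`q` colors takes equal values at neighbouring positions. -/
def blockBound : ℕ → ℕ → ℕ
  | 0, _ => 1
  | n + 1, q => 4 * q * blockBound n (2 ^ q) ^ 2

theorem blockBound_pos (n : ℕ) {q : ℕ} (hq : 0 < q) : 0 < blockBound n q := by
  induction n generalizing q with
  | zero => simp [blockBound]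
  | succ n ih =>
    have := ih (q := 2 ^ q) (by positivity)
    rw [blockBound]
    positivity

theorem measurableSet_section_gt {ν : Measure (ι → B)} [SFinite ν] (S : Set ι) (δ : ℝ≥0∞)
    {A : Set (ι → B)} (hA : MeasurableSet A) :
    MeasurableSet {u | δ < ν {u' | mix S u u' ∈ A}} :=
  measurableSet_lt measurable_const (measurable_measure_prodMk_left (measurable_mix S hA))

/-- If `f` takes finitely many values and depends only on the layers `0, …, n - 1`, then with
probability bounded below it agrees with its translate by one layer. -/
theorem inv_blockBound_le_measure_eq_shift (μ : Measure B) [IsProbabilityMeasure μ] (σ : ι ≃ ι)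
    (ℓ : ι → ℤ) (hσ : ∀ i, ℓ (σ i) = ℓ i + 1) (n : ℕ) :
    ∀ {α : Type} [Fintype α] (f : (ι → B) → α), (∀ k, MeasurableSet {u | f u = k}) →
      (∀ u u' : ι → B, (∀ i, 0 ≤ ℓ i → ℓ i < n → u i = u' i) → f u = f u') →
      (blockBound n (Fintype.card α) : ℝ≥0∞)⁻¹ ≤
        (Measure.infinitePi fun _ : ι => μ) {u | f u = f fun i => u (σ i)} := by
  classical
  induction n with
  | zero =>
    intro α _ f _ hf
    have : {u : ι → B | f u = f fun i => u (σ i)} = Set.univ := by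
      ext u
      simp only [Set.mem_ofPred_eq, Set.mem_univ, iff_true]
      exact hf _ _ fun i h0 h1 => by simp at h1; omega
    simp [this, blockBound]
  | succ n ih =>
    intro α _ f hfm hf
    set ν := Measure.infinitePi fun _ : ι => μ with hν
    obtain ⟨u₀⟩ : Nonempty (ι → B) := ν.nonempty_of_neZero
    set q := Fintype.card α with hq
    have hqpos : 0 < q := Fintype.card_pos_iff.2 ⟨f u₀⟩
    set S : Set ι := {i | ℓ i = n} with hS
    set S' : Set ι := {i | ℓ i = n + 1} with hS'
    set θ : (ι → B) → (ι → B) := fun u i => u (σ i) with hθ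
    have hθpres : MeasurePreserving θ ν ν :=
      ⟨by fun_prop, Measure.map_infinitePi_infinitePi_of_inj (P := fun _ : ι => μ) σ.injective⟩
    set p : ℝ≥0∞ := (blockBound n (2 ^ q) : ℝ≥0∞)⁻¹ with hp
    have hT : 0 < blockBound n (2 ^ q) := blockBound_pos n (by positivity)
    have hptop : p ≠ ∞ := by simp [hp, hT.ne']
    -- With this threshold the unlikely colors have total probability at most `q * δ = p / 2`, which
    -- leaves half of `p`.
    set δ : ℝ≥0∞ := p / (2 * q) with hδ
    set h : (ι → B) → Finset α := fun u => {k | δ < ν {u' | f (mix S u u') = k}} with hh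
    have mem_h : ∀ u k, k ∈ h u ↔ δ < ν {u' | f (mix S u u') = k} := by
      intro u k; simp [hh]
    have hEm : ∀ k, MeasurableSet {u | k ∈ h u} := by
      intro k
      simp only [mem_h]
      exact measurableSet_section_gt S δ (hfm k)
    have hhm : ∀ A, MeasurableSet {u | h u = A} := by
      intro A
      have : {u | h u = A} = ⋂ k, {u | k ∈ h u ↔ k ∈ A} := by
        ext u; simp [Finset.ext_iff]
      rw [this]
      refine MeasurableSet.iInter fun k => ?_
      by_cases hk : k ∈ A
      · simpa [hk] using hEm k
      · simp only [hk, iff_false]; exact (hEm k).compl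
    have hhdep : ∀ u u' : ι → B, (∀ i, 0 ≤ ℓ i → ℓ i < n → u i = u' i) → h u = h u' := by
      intro u u' huu
      ext k
      rw [mem_h, mem_h]
      have : ∀ w, f (mix S u w) = f (mix S u' w) := by
        intro w
        refine hf _ _ fun i h0 h1 => ?_
        by_cases hi : i ∈ S
        · rw [mix_of_mem hi, mix_of_mem hi]
        · rw [mix_of_notMem hi, mix_of_notMem hi]
          refine huu i h0 ?_
          have : ℓ i ≠ n := hi
          push_cast at h1
          omega
      simp only [this]
    have key := ih h hhm hhdep
    rw [Fintype.card_finset] at key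
    -- the color is rarely outside `h`
    have hout : ν {u | f u ∉ h u} ≤ q * δ := by
      have hm : MeasurableSet {u | f u ∉ h u} := by
        have : {u | f u ∉ h u} = ⋃ k, ({u | f u = k} ∩ {u | k ∈ h u}ᶜ) := by
          ext u; simp
        rw [this]
        exact MeasurableSet.iUnion fun k => (hfm k).inter (hEm k).compl
      rw [← (measurePreserving_mix μ S).measure_preimage hm.nullMeasurableSet,
        Measure.prod_apply (measurable_mix S hm)]
      calc _ ≤ ∫⁻ _, q * δ ∂ν := by
            refine lintegral_mono fun u => ?_
            have : (Prod.mk u ⁻¹' ((fun p : (ι → B) × (ι → B) => mix S p.1 p.2) ⁻¹'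
                {u | f u ∉ h u})) ⊆ ⋃ k ∈ (h u)ᶜ, {u' | f (mix S u u') = k} := by
              intro u' hu'
              simp only [Set.mem_preimage, Set.mem_ofPred_eq] at hu'
              have : h (mix S u u') = h u := hhdep _ _ fun i _ h1 => by
                rw [mix_of_notMem]; intro hi; have : ℓ i = n := hi; omega
              rw [this] at hu'
              simpa using hu'
            refine (measure_mono this).trans ((measure_biUnion_finset_le _ _).trans ?_)
            calc _ ≤ ∑ k ∈ (h u)ᶜ, δ := Finset.sum_le_sum fun k hk => by
                  rw [Finset.mem_compl, mem_h, not_lt] at hk; exact hk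
              _ ≤ _ := by
                rw [Finset.sum_const, nsmul_eq_mul]
                gcongr
                exact (Finset.card_le_univ _)
        _ = q * δ := by simp
    -- Where `h` agrees with its translate, the color lies in the translated set unless it is
    -- outside its own.
    have hin : p ≤ ν {u | f u ∈ h (θ u)} + q * δ := by
      calc p ≤ ν {u | h u = h (θ u)} := key
        _ ≤ ν ({u | f u ∈ h (θ u)} ∪ {u | f u ∉ h u}) := by
          refine measure_mono fun u hu => ?_
          by_cases hc : f u ∈ h u
          · left; have : h u = h (θ u) := hu
            simpa [← this] using hc
          · right; exact hc
        _ ≤ _ := (measure_union_le _ _).trans (by gcongr)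
    have hqδ : q * δ = p / 2 := by
      rw [hδ, ← mul_div_assoc, mul_comm 2 (q : ℝ≥0∞)]
      exact ENNReal.mul_div_mul_left _ _ (by simpa using hqpos.ne') (by simp)
    have hhalf : p / 2 ≤ ν {u | f u ∈ h (θ u)} := by
      rw [hqδ] at hin
      have := tsub_le_iff_right.2 hin
      rwa [ENNReal.sub_half hptop] at this
    -- Layer `n + 1` is invisible to `f` at `u` but is the last layer seen by `f` at `θ u`.
    -- Resampling it keeps the first color and, by definition of `h`, reproduces it at `θ u` with
    -- probability above `δ`.
    have hfin : δ * ν {u | f u ∈ h (θ u)} ≤ ν {u | f u = f (θ u)} := by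
      have hm : MeasurableSet {u | f u = f (θ u)} := by
        have : {u | f u = f (θ u)} = ⋃ k, ({u | f u = k} ∩ θ ⁻¹' {u | f u = k}) := by
          ext u; simp [eq_comm]
        rw [this]
        exact MeasurableSet.iUnion fun k => (hfm k).inter (hθpres.measurable (hfm k))
      have hm' : MeasurableSet {u | f u ∈ h (θ u)} := by
        have : {u | f u ∈ h (θ u)} = ⋃ k, ({u | f u = k} ∩ θ ⁻¹' {u | k ∈ h u}) := by
          ext u; simp
        rw [this]
        exact MeasurableSet.iUnion fun k => (hfm k).inter (hθpres.measurable (hEm k))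
      rw [← (measurePreserving_mix μ S').measure_preimage hm.nullMeasurableSet,
        Measure.prod_apply (measurable_mix S' hm), ← lintegral_indicator_const hm']
      refine lintegral_mono fun u => ?_
      by_cases hu : f u ∈ h (θ u)
      · have hu2 := (mem_h _ _).1 hu
        rw [Set.indicator_of_mem (show u ∈ {u | f u ∈ h (θ u)} from hu)]
        refine hu2.le.trans ?_
        have hmk : MeasurableSet {u' | f (mix S (θ u) u') = f u} :=
          ((measurable_mix S).comp measurable_prodMk_left) (hfm (f u))
        rw [← hθpres.measure_preimage hmk.nullMeasurableSet]
        refine measure_mono fun u' hu' => ?_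
        simp only [Set.mem_preimage, Set.mem_ofPred_eq] at hu' ⊢
        have e1 : θ (mix S' u u') = mix S (θ u) (θ u') := by
          funext i
          by_cases hi : i ∈ S
          · have : σ i ∈ S' := by
              have : ℓ i = n := hi
              simp only [hS', Set.mem_ofPred_eq, hσ, this]
            simp only [hθ]
            rw [mix_of_mem this, mix_of_mem hi]
          · have : σ i ∉ S' := by
              have : ℓ i ≠ n := hi
              simp only [hS', Set.mem_ofPred_eq, hσ]
              omega
            simp only [hθ]
            rw [mix_of_notMem this, mix_of_notMem hi]
        have e2 : f (mix S' u u') = f u := hf _ _ fun i _ h1 => by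
          rw [mix_of_notMem]
          intro hi; have : ℓ i = n + 1 := hi; push_cast at h1; omega
        rw [e1, e2, hu']
      · rw [Set.indicator_of_notMem (show u ∉ {u | f u ∈ h (θ u)} from hu)]
        exact zero_le
    calc (blockBound (n + 1) q : ℝ≥0∞)⁻¹ = δ * (p / 2) := by
          rw [blockBound, hδ, hp]
          simp only [div_eq_mul_inv]
          have hT0 : (blockBound n (2 ^ q) : ℝ≥0∞) ≠ 0 := by simp [hT.ne']
          have hTt : (blockBound n (2 ^ q) : ℝ≥0∞) ≠ ∞ := ENNReal.natCast_ne_top _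
          have hqt : (2 * q : ℝ≥0∞) ≠ ∞ := ENNReal.mul_ne_top (by simp) (by simp)
          rw [← ENNReal.mul_inv (.inl hT0) (.inl hTt), ← ENNReal.mul_inv (.inl hT0) (.inl hTt),
            ← ENNReal.mul_inv (.inl (mul_ne_zero hT0 (by simpa using hqpos.ne')))
              (.inl (ENNReal.mul_ne_top hTt hqt))]
          congr 1
          push_cast
          ring
      _ ≤ δ * ν {u | f u ∈ h (θ u)} := by gcongr
      _ ≤ _ := hfin

end Block

/-! ### Growth of the tower function -/

section Tower

theorem tower_zero : tower 0 = 1 := rfl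

theorem tower_succ (n : ℕ) : tower (n + 1) = Real.exp (tower n) :=
  Function.iterate_succ_apply' _ _ _

theorem natCast_add_one_le_tower (n : ℕ) : (n : ℝ) + 1 ≤ tower n := by
  induction n with
  | zero => simp [tower_zero]
  | succ n ih =>
    rw [tower_succ]
    push_cast
    linarith [Real.add_one_le_exp (tower n)]

theorem one_le_tower (n : ℕ) : 1 ≤ tower n := by
  have := natCast_add_one_le_tower n
  have := n.cast_nonneg (α := ℝ)
  linarith

theorem tower_pos (n : ℕ) : 0 < tower n := one_pos.trans_le (one_le_tower n)

theorem tower_strictMono : StrictMono tower :=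
  strictMono_nat_of_lt_succ fun n => by
    rw [tower_succ]
    linarith [Real.add_one_le_exp (tower n)]

theorem two_mul_tower_lt (n : ℕ) : 2 * tower n < tower (n + 1) := by
  rw [tower_succ]
  have h1 := one_le_tower n
  have h2 : Real.exp (tower n) = Real.exp 1 * Real.exp (tower n - 1) := by
    rw [← Real.exp_add]; ring_nf
  have h3 := Real.add_one_le_exp (tower n - 1)
  have h4 := Real.exp_one_gt_d9
  rw [h2]
  nlinarith

/-- The term `t ^ 5 / 120` of the exponential series suffices as soon as `t ^ 2 ≥ 480`. -/
theorem four_mul_pow_three_le_exp {t : ℝ} (ht : 22 ≤ t) : 4 * t ^ 3 ≤ Real.exp t := by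
  have h := Real.pow_div_factorial_le_exp t (by linarith) 5
  have h5 : (Nat.factorial 5 : ℝ) = 120 := by norm_num [Nat.factorial]
  rw [h5] at h
  refine le_trans ?_ h
  rw [le_div_iff₀ (by norm_num)]
  have : 0 ≤ t ^ 3 * (t ^ 2 - 480) := mul_nonneg (by positivity) (by nlinarith)
  nlinarith

theorem two_pow_le_exp (q : ℕ) : (2 : ℝ) ^ q ≤ Real.exp q := by
  have h4 := Real.exp_one_gt_d9
  calc (2 : ℝ) ^ q ≤ Real.exp 1 ^ q := by gcongr; linarith
    _ = Real.exp q := by rw [← Real.exp_nat_mul, mul_one]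

/-- One step of the recursion costs two tower levels: one for passing from `q` to `2 ^ q`, one for
absorbing the square and the factor `4 * q`. The condition on `m` makes the arguments large enough
for the latter. -/
theorem blockBound_le_tower (n : ℕ) {m q : ℕ} (hm : 3 ≤ m) (hq : (q : ℝ) ≤ tower m) :
    (blockBound n q : ℝ) ≤ tower (m + 2 * n) := by
  induction n generalizing m q with
  | zero => simpa [blockBound] using one_le_tower m
  | succ n ih =>
    have h2 : ((2 ^ q : ℕ) : ℝ) ≤ tower (m + 1) := by
      rw [tower_succ]
      push_cast
      exact (two_pow_le_exp q).trans (Real.exp_le_exp.2 hq)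
    have h3 := ih (m := m + 1) (by omega) h2
    set t := tower (m + 1 + 2 * n) with ht
    have hqt : (q : ℝ) ≤ t := hq.trans (tower_strictMono.monotone (by omega))
    have h22 : 22 ≤ t := by
      have h : tower 4 ≤ t := tower_strictMono.monotone (by omega)
      refine le_trans ?_ h
      rw [tower_succ]
      have h4 : (4 : ℝ) ≤ tower 3 := by
        have := natCast_add_one_le_tower 3
        push_cast at this
        linarith
      have h5 := Real.exp_one_gt_d9
      calc (22 : ℝ) ≤ 2.5 ^ 4 := by norm_num
        _ ≤ Real.exp 1 ^ 4 := by gcongr; linarith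
        _ = Real.exp 4 := by rw [← Real.exp_nat_mul]; norm_num
        _ ≤ _ := Real.exp_le_exp.2 h4
    have : m + 2 * (n + 1) = (m + 1 + 2 * n) + 1 := by ring
    rw [this, tower_succ, ← ht, blockBound]
    refine le_trans ?_ (four_mul_pow_three_le_exp h22)
    push_cast
    calc 4 * (q : ℝ) * (blockBound n (2 ^ q) : ℝ) ^ 2 ≤ 4 * t * t ^ 2 := by gcongr
      _ = 4 * t ^ 3 := by ring

end Tower

/-! ### Coding radius and determination by a ball -/

section CodingRadius

variable {d : ℕ} {A B : Type*} {F : (Site d → B) → (Site d → A)} {y : Site d → B}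

theorem Determines.mono {r s : ℕ} (h : Determines F y r) (hrs : r ≤ s) : Determines F y s :=
  fun y' hy' => h y' fun v hv => hy' v (le_trans (show norm1 v ≤ r from hv) hrs)

theorem codingRadius_le_of_determines {n : ℕ} (h : Determines F y n) :
    codingRadius F y ≤ n := iInf₂_le n h

theorem lt_codingRadius_of_not_determines {r : ℝ}
    (h : ¬ Determines F y ⌊r⌋₊) : ENNReal.ofReal r < (codingRadius F y : ℝ≥0∞) := by
  have h1 : ((⌊r⌋₊ + 1 : ℕ) : ℕ∞) ≤ codingRadius F y := by
    refine le_iInf₂ fun s hs => ?_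
    have : ¬ s ≤ ⌊r⌋₊ := fun hle => h (hs.mono hle)
    exact_mod_cast (by omega : ⌊r⌋₊ + 1 ≤ s)
  have h2 : ((⌊r⌋₊ + 1 : ℕ) : ℝ≥0∞) ≤ (codingRadius F y : ℝ≥0∞) := by
    have := ENat.toENNReal_le.2 h1
    simpa using this
  refine lt_of_lt_of_le ?_ h2
  rw [ENNReal.ofReal_lt_natCast (by omega)]
  exact_mod_cast Nat.lt_floor_add_one r

theorem not_lt_codingRadius_of_determines {r : ℝ} {n : ℕ} (hnr : n ≤ r)
    (h : Determines F y n) : ¬ ENNReal.ofReal r < (codingRadius F y : ℝ≥0∞) := by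
  rw [not_lt]
  have h1 : (codingRadius F y : ℝ≥0∞) ≤ n := by
    have := ENat.toENNReal_le.2 (codingRadius_le_of_determines h)
    simpa using this
  refine h1.trans ?_
  rw [← ENNReal.ofReal_natCast]
  exact ENNReal.ofReal_le_ofReal hnr

end CodingRadius

/-! ### The lower bound on the tail -/

section LowerBound

variable {d q : ℕ} {Ω B : Type*} [MeasurableSpace Ω] [MeasurableSpace B] {P : Measure Ω} {Y : Site d → Ω → B} {F : (Site d → B) → (Site d → Fin q)}
  {X : Ω → Site d → Fin q}

theorem IsIID.map_config (h : IsIID P Y) :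
    P.map (config Y) = Measure.infinitePi fun _ : Site d => P.map (Y 0) := by
  have h1 := h.indep.map_fun_eq_infinitePi_map h.measurable
  have h2 : (fun v => P.map (Y v)) = fun _ => P.map (Y 0) :=
    funext fun v => (h.identDistrib v 0).map_eq
  rw [h2] at h1
  exact h1

theorem IsIID.measurable_config (h : IsIID P Y) : Measurable (config Y) :=
  measurable_pi_lambda _ h.measurable

theorem measurableSet_color_eq (hF : IsFactorMap F) (u v : Site d) :
    MeasurableSet {y | F y u = F y v} :=
  measurableSet_eq_fun ((measurable_pi_apply u).comp hF.measurable)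
    ((measurable_pi_apply v).comp hF.measurable)

theorem IsFactorMap.apply_shift {A : Type*} [MeasurableSpace A]
    {F : (Site d → B) → (Site d → A)} (hF : IsFactorMap F) (y : Site d → B) (e : Site d) :
    F (fun v => y (v + e)) 0 = F y e := by
  have h : translate (-e) y = fun v => y (v + e) := by
    funext v; simp [translate]
  rw [← h, hF.equivariant]
  simp [translate]

theorem IsFFIID.ae_ne (h : IsFFIID P Y F X) (hX : IsColoring P X) {e : Site d}
    (he : norm1 e = 1) : ∀ᵐ y ∂(P.map (config Y)), F y 0 ≠ F y e := by
  rw [ae_map_iff (p := fun y => F y 0 ≠ F y e) h.iid.measurable_config.aemeasurable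
    (measurableSet_color_eq h.factor 0 e).compl]
  filter_upwards [h.eq_factor, hX.proper] with ω h1 h2
  rw [← h1]
  refine h2 0 e ?_
  rw [← he]
  simp [norm1]

/-- If the variable at a site alone forced some color `k` with positive probability, independence
would let two neighbours both be forced to `k`. -/
theorem ae_not_determines_zero [IsProbabilityMeasure P] (h : IsFFIID P Y F X) (hX : IsColoring P X) {e : Site d}
    (he : norm1 e = 1) : ∀ᵐ ω ∂P, ¬ Determines F (config Y ω) 0 := by
  have he0 : e ≠ 0 := by rintro rfl; simp [norm1] at he
  have : IsProbabilityMeasure (P.map (Y 0)) :=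
    Measure.isProbabilityMeasure_map (h.iid.measurable 0).aemeasurable
  set μ := P.map (Y 0) with hμ
  set ν := Measure.infinitePi fun _ : Site d => μ with hν
  have hlaw : P.map (config Y) = ν := h.iid.map_config
  have hne := h.ae_ne hX he
  rw [hlaw] at hne
  -- These sets need not be measurable. Hence the sites `0` and `e` are resampled in turn, and
  -- values in `S k` are found through `∃ᵐ`.
  let S : Fin q → Set B := fun k => {b | ∀ y : Site d → B, y 0 = b → F y 0 = k}
  have hS : ∀ k, μ (S k) = 0 := by
    intro k
    by_contra hk
    have hf : ∃ᵐ b ∂μ, b ∈ S k := by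
      rw [frequently_ae_iff]; exact hk
    have h1 : ∀ᵐ y ∂ν, ∀ᵐ b ∂μ, F (Function.update y e b) 0 ≠ F (Function.update y e b) e :=
      Measure.ae_ae_of_ae_prod ((measurePreserving_update μ e).quasiMeasurePreserving.ae hne)
    have h2 : ∀ᵐ y ∂ν, ∀ᵐ a ∂μ, ∀ᵐ b ∂μ, F (Function.update (Function.update y 0 a) e b) 0 ≠
        F (Function.update (Function.update y 0 a) e b) e :=
      Measure.ae_ae_of_ae_prod ((measurePreserving_update μ 0).quasiMeasurePreserving.ae h1)
    obtain ⟨y, hy⟩ := h2.exists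
    obtain ⟨a, ha, haS⟩ := (hy.and_frequently hf).exists
    obtain ⟨b, hb, hbS⟩ := (ha.and_frequently hf).exists
    apply hb
    rw [haS _ (by simp [he0.symm]), ← h.factor.apply_shift _ e, hbS _ (by simp)]
  have hSall : ∀ᵐ ω ∂P, ∀ k, Y 0 ω ∉ S k := by
    rw [ae_all_iff]
    intro k
    exact ae_of_ae_map (h.iid.measurable 0).aemeasurable (measure_eq_zero_iff_ae_notMem.1 (hS k))
  filter_upwards [hSall] with ω hω hdet
  refine hω (F (config Y ω) 0) fun y hy => hdet y fun v hv => ?_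
  have hv0 : v = 0 := by
    have : norm1 v ≤ 0 := hv
    simpa [norm1, funext_iff] using this
  rw [hv0, hy]; rfl

/-- When the block factor takes equal values at `0` and `e`, it differs from the proper coloring at
one of them; by stationarity both errors have the same probability. -/
theorem inv_blockBound_le_two_mul_measure [IsProbabilityMeasure P] (h : IsFFIID P Y F X) (hX : IsColoring P X)
    (i₀ : Fin d) (n : ℕ) :
    (blockBound (2 * n + 1) q : ℝ≥0∞)⁻¹ ≤ 2 * P {ω | ¬ Determines F (config Y ω) n} := by
  set e : Site d := Pi.single i₀ 1 with he_def
  have he : norm1 e = 1 := by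
    rw [norm1, Finset.sum_eq_single i₀] <;> simp +contextual [he_def]
  have : IsProbabilityMeasure (P.map (Y 0)) :=
    Measure.isProbabilityMeasure_map (h.iid.measurable 0).aemeasurable
  set μ := P.map (Y 0) with hμ
  set ν := Measure.infinitePi fun _ : Site d => μ with hν
  have hlaw : P.map (config Y) = ν := h.iid.map_config
  have hne := h.ae_ne hX he
  rw [hlaw] at hne
  obtain ⟨y₀⟩ : Nonempty (Site d → B) := ν.nonempty_of_neZero
  -- Freezing the outside of the ball gives a measurable function of the ball, correct whenever the
  -- ball determines the color. The event of an error is measurable even if `Determines` is not.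
  let f : (Site d → B) → Fin q := fun y => F (mix (ball d n)ᶜ y y₀) 0
  have hfm : Measurable f := (measurable_pi_apply 0).comp (h.factor.measurable.comp
    ((measurable_mix (ball d n)ᶜ).comp (measurable_id.prodMk measurable_const)))
  have hfdet : ∀ y, Determines F y n → F y 0 = f y := fun y hy =>
    (hy _ fun v hv => mix_of_notMem (by simpa using hv)).symm
  have hm : MeasurableSet {y | F y 0 ≠ f y} :=
    (measurableSet_eq_fun ((measurable_pi_apply 0).comp h.factor.measurable) hfm).compl
  have hbad : ν {y | F y 0 ≠ f y} ≤ P {ω | ¬ Determines F (config Y ω) n} := by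
    rw [← hlaw, Measure.map_apply h.iid.measurable_config hm]
    exact measure_mono fun ω hω hdet => hω (hfdet _ hdet)
  let θ : (Site d → B) → (Site d → B) := fun y v => y (v + e)
  have hθ : MeasurePreserving θ ν ν :=
    ⟨by fun_prop, Measure.map_infinitePi_infinitePi_of_inj (P := fun _ : Site d => μ)
      (add_left_injective e)⟩
  -- The offset `n` places the ball in the layers `0, …, 2 * n`.
  have key := inv_blockBound_le_measure_eq_shift μ (Equiv.addRight e)
    (fun v : Site d => v i₀ + n) (fun v => by simp [he_def]; ring) (2 * n + 1) f
    (fun k => hfm (measurableSet_singleton k)) (fun y y' hyy => by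
      have : mix (ball d n)ᶜ y y₀ = mix (ball d n)ᶜ y' y₀ := by
        funext v
        by_cases hv : v ∈ ball d n
        · rw [mix_of_notMem (by simpa using hv), mix_of_notMem (by simpa using hv)]
          have h1 : (v i₀).natAbs ≤ n :=
            (Finset.single_le_sum (f := fun i => (v i).natAbs) (fun _ _ => Nat.zero_le _)
              (Finset.mem_univ i₀)).trans hv
          exact hyy v (by omega) (by push_cast; omega)
        · rw [mix_of_mem hv, mix_of_mem hv]
      simp only [f, this])
  rw [Fintype.card_fin] at key
  refine key.trans ?_
  calc ν {y | f y = f (θ y)}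
      ≤ ν ({y | F y 0 ≠ f y} ∪ θ ⁻¹' {y | F y 0 ≠ f y} ∪ {y | ¬ F y 0 ≠ F y e}) := by
        refine measure_mono fun y hy => ?_
        by_contra hc
        simp only [Set.mem_union, Set.mem_preimage, Set.mem_ofPred_eq, not_or, not_not] at hc
        obtain ⟨⟨h1, h2⟩, h3⟩ := hc
        rw [h.factor.apply_shift] at h2
        exact h3 (h1.trans (Eq.trans hy h2.symm))
    _ ≤ ν {y | F y 0 ≠ f y} + ν {y | F y 0 ≠ f y} + 0 := by
        refine (measure_union_le _ _).trans (add_le_add ((measure_union_le _ _).trans ?_) ?_)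
        · rw [hθ.measure_preimage hm.nullMeasurableSet]
        · exact (ae_iff.1 hne).le
    _ ≤ _ := by rw [add_zero, two_mul]; gcongr

theorem one_lt_towerReal {x : ℝ} (h : 1 ≤ x) : 1 < towerReal x := by
  have : 1 ≤ ⌊x⌋₊ := Nat.le_floor (by simpa using h)
  have h2 : tower 0 < towerReal x := tower_strictMono (by omega)
  simpa [tower_zero] using h2

theorem towerReal_pos (x : ℝ) : 0 < towerReal x := tower_pos _

/-- The lower bound: the coding radius of an ffiid coloring has at best a tower tail. -/
theorem exists_le_radiusTail (d q : ℕ) (hd : 0 < d) :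
    ∃ C : ℝ, 0 < C ∧ ∀ (Ω : Type u) [MeasurableSpace Ω] (P : Measure Ω) [IsProbabilityMeasure P]
        (B : Type v) [MeasurableSpace B]
        (Y : Site d → Ω → B) (F : (Site d → B) → (Site d → Fin q)) (X : Ω → Site d → Fin q),
        IsFFIID P Y F X → IsColoring P X →
        ∀ r : ℝ, 0 ≤ r →
          1 / towerReal (C * r) ≤ radiusTail P Y F r ∧
          (1 ≤ C * r → 1 / towerReal (C * r) < radiusTail P Y F r) := by
  set m := q + 3 with hm
  -- For `n ≥ 1` the height needed is `m + 2 * (2 * n + 1) + 1 ≤ (m + 7) * n`; the final `+ 1`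
  -- absorbs the factor 2 and makes the inequality strict.
  refine ⟨m + 7, by positivity, ?_⟩
  intro Ω _ P _ B _ Y F X h hX r hr
  have hsub : {ω | ¬ Determines F (config Y ω) ⌊r⌋₊} ⊆
      {ω | ENNReal.ofReal r < (codingRadius F (config Y ω) : ℝ≥0∞)} :=
    fun ω hω => lt_codingRadius_of_not_determines hω
  have hmono : P.real {ω | ¬ Determines F (config Y ω) ⌊r⌋₊} ≤ radiusTail P Y F r :=
    measureReal_mono hsub
  -- Near `r = 0` the required bound is 1, so there the tail must be exactly 1: no site is
  -- determined by its own variable.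
  rcases lt_or_ge r 1 with hr1 | hr1
  · have hfl : ⌊r⌋₊ = 0 := Nat.floor_eq_zero.2 hr1
    have hone : P.real {ω | ¬ Determines F (config Y ω) ⌊r⌋₊} = 1 := by
      rw [hfl, measureReal_def]
      have he : norm1 (Pi.single (⟨0, hd⟩ : Fin d) 1 : Site d) = 1 := by
        rw [norm1, Finset.sum_eq_single (⟨0, hd⟩ : Fin d)] <;> simp +contextual
      rw [measure_congr (Filter.eventuallyEq_univ.2 (ae_not_determines_zero h hX he))]
      simp
    rw [hone] at hmono
    constructor
    · refine le_trans ?_ hmono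
      rw [div_le_one (towerReal_pos _)]
      exact one_le_tower _
    · intro h1
      refine lt_of_lt_of_le ?_ hmono
      rw [div_lt_one (towerReal_pos _)]
      exact one_lt_towerReal h1
  · set n := ⌊r⌋₊ with hn
    have hn1 : 1 ≤ n := Nat.le_floor (by simpa using hr1)
    have hnr : (n : ℝ) ≤ r := Nat.floor_le hr
    have hb := inv_blockBound_le_two_mul_measure h hX ⟨0, hd⟩ n
    have hq0 : 0 < q := by
      obtain ⟨ω⟩ : Nonempty Ω := P.nonempty_of_neZero
      exact Fin.pos (X ω 0)
    have hT := blockBound_pos (2 * n + 1) hq0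
    have hb' : ((blockBound (2 * n + 1) q : ℝ))⁻¹ ≤
        2 * P.real {ω | ¬ Determines F (config Y ω) n} := by
      have := ENNReal.toReal_mono (by finiteness) hb
      simpa [measureReal_def] using this
    have hqm : (q : ℝ) ≤ tower m := by
      have := natCast_add_one_le_tower m
      rw [hm] at this ⊢
      push_cast at this
      linarith
    have hTt := blockBound_le_tower (2 * n + 1) (m := m) (by omega) hqm
    have hTpos : (0 : ℝ) < blockBound (2 * n + 1) q := by exact_mod_cast hT
    have hlt : 2 * (blockBound (2 * n + 1) q : ℝ) < towerReal ((m + 7) * r) := by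
      calc 2 * (blockBound (2 * n + 1) q : ℝ) ≤ 2 * tower (m + 2 * (2 * n + 1)) := by gcongr
        _ < tower (m + 2 * (2 * n + 1) + 1) := two_mul_tower_lt _
        _ ≤ towerReal ((m + 7) * r) := by
          refine tower_strictMono.monotone (Nat.le_floor ?_)
          have h1 : m + 2 * (2 * n + 1) + 1 ≤ (m + 7) * n := by nlinarith
          calc ((m + 2 * (2 * n + 1) + 1 : ℕ) : ℝ) ≤ (((m + 7) * n : ℕ) : ℝ) := by
                exact_mod_cast h1
            _ ≤ _ := by push_cast; gcongr
    have hstrict : 1 / towerReal ((m + 7) * r) < radiusTail P Y F r := by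
      refine lt_of_lt_of_le ?_ hmono
      rw [div_lt_iff₀ (towerReal_pos _)]
      rw [inv_le_iff_one_le_mul₀ hTpos] at hb'
      have hp : 0 < P.real {ω | ¬ Determines F (config Y ω) n} := by
        by_contra hc
        have := measureReal_nonneg (μ := P) (s := {ω | ¬ Determines F (config Y ω) n})
        have h0 : P.real {ω | ¬ Determines F (config Y ω) n} = 0 := by linarith
        rw [h0] at hb'
        norm_num at hb'
      nlinarith
    exact ⟨hstrict.le, fun _ => hstrict⟩

end LowerBound

/-! ### Greedy maximal independent sets -/

section Greedy

variable {d : ℕ} {D : Finset (Site d)}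

theorem norm1_add_le (v w : Site d) : norm1 (v + w) ≤ norm1 v + norm1 w := by
  rw [norm1, norm1, norm1, ← Finset.sum_add_distrib]
  exact Finset.sum_le_sum fun i _ => Int.natAbs_add_le _ _

/-- `M` is a maximal independent set of the Cayley graph of `ℤ^d` with connection set `D`. -/
structure IsNet (D : Finset (Site d)) (M : Set (Site d)) : Prop where
  sep : ∀ ⦃v⦄, v ∈ M → ∀ w ∈ D, v + w ∉ M
  dom : ∀ ⦃v⦄, v ∉ M → ∃ w ∈ D, v + w ∈ M

/-- The sites selected before time `t` by the greedy algorithm that at time `t` treats the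
sites in `A t`. -/
def select (D : Finset (Site d)) (A : ℕ → Set (Site d)) : ℕ → Set (Site d)
  | 0 => ∅
  | t + 1 => select D A t ∪ {v | v ∈ A t ∧ ∀ w ∈ D, v + w ∉ select D A t}

theorem select_mono (A : ℕ → Set (Site d)) : Monotone (select D A) :=
  monotone_nat_of_le_succ fun _ => Set.subset_union_left

theorem exists_of_mem_select {A : ℕ → Set (Site d)} {s : ℕ} {v : Site d}
    (h : v ∈ select D A s) : ∃ t < s, v ∈ A t ∧ ∀ w ∈ D, v + w ∉ select D A t := by
  induction s with
  | zero => exact h.elim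
  | succ s ih =>
    rcases h with h | h
    · obtain ⟨t, ht, h⟩ := ih h
      exact ⟨t, by omega, h⟩
    · exact ⟨s, by omega, h⟩

/-- The set selected by the greedy algorithm. -/
def greedy (D : Finset (Site d)) (A : ℕ → Set (Site d)) : Set (Site d) := ⋃ t, select D A t

/-- A site treated only once has its fate settled in that round; this makes the infinite greedy
procedure local. -/
theorem mem_greedy_iff {A : ℕ → Set (Site d)} (huniq : ∀ v t t', v ∈ A t → v ∈ A t' → t = t')
    {v : Site d} {t : ℕ} (hv : v ∈ A t) : v ∈ greedy D A ↔ v ∈ select D A (t + 1) := by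
  refine ⟨fun h => ?_, fun h => Set.mem_iUnion.2 ⟨_, h⟩⟩
  obtain ⟨s, hs⟩ := Set.mem_iUnion.1 h
  obtain ⟨t', _, h1, h2⟩ := exists_of_mem_select hs
  obtain rfl := huniq v _ _ hv h1
  exact Or.inr ⟨h1, h2⟩

/-- Of two neighbours the later one is blocked by the earlier, and simultaneous treatment is
excluded. A site is rejected only because of a selected neighbour. -/
theorem isNet_greedy {A : ℕ → Set (Site d)} (hsymm : ∀ w ∈ D, -w ∈ D)
    (hprop : ∀ v t, v ∈ A t → ∀ w ∈ D, v + w ∉ A t) (hex : ∀ v, ∃ t, v ∈ A t) :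
    IsNet D (greedy D A) := by
  have key : ∀ v ∈ greedy D A, ∃ t, v ∈ A t ∧ v ∈ select D A (t + 1) ∧
      ∀ w ∈ D, v + w ∉ select D A t := by
    intro v hv
    obtain ⟨s, hs⟩ := Set.mem_iUnion.1 hv
    obtain ⟨t, _, h1, h2⟩ := exists_of_mem_select hs
    exact ⟨t, h1, Or.inr ⟨h1, h2⟩, h2⟩
  constructor
  · intro v hv w hw hvw
    obtain ⟨t, h1, h2, h3⟩ := key v hv
    obtain ⟨t', h1', h2', h3'⟩ := key _ hvw
    rcases lt_trichotomy t t' with h | rfl | h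
    · refine h3' (-w) (hsymm w hw) ?_
      rw [add_neg_cancel_right]
      exact select_mono A h h2
    · exact hprop v t h1 w hw h1'
    · exact h3 w hw (select_mono A h h2')
  · intro v hv
    obtain ⟨t, ht⟩ := hex v
    by_contra! hc
    exact hv (Set.mem_iUnion.2 ⟨t + 1, Or.inr ⟨ht, fun w hw h =>
      hc w hw (Set.mem_iUnion.2 ⟨t, h⟩)⟩⟩)

/-- Each round looks one neighbourhood further. The margin `ρ * (t + 1)` matches the range on which
`stage` at time `t` depends. -/
theorem select_congr {A A' : ℕ → Set (Site d)} {ρ R : ℕ} (hρ : ∀ w ∈ D, norm1 w ≤ ρ)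
    (hA : ∀ t v, norm1 v + ρ * (t + 1) ≤ R → (v ∈ A t ↔ v ∈ A' t)) (t : ℕ) :
    ∀ v, norm1 v + ρ * (t + 1) ≤ R → (v ∈ select D A t ↔ v ∈ select D A' t) := by
  induction t with
  | zero => intro v _; rfl
  | succ t ih =>
    intro v hv
    have h0 : norm1 v + ρ * (t + 1) ≤ R := by nlinarith
    have h1 : ∀ w ∈ D, (v + w ∈ select D A t ↔ v + w ∈ select D A' t) := fun w hw => by
      refine ih _ ?_
      have := norm1_add_le v w
      have := hρ w hw
      nlinarith
    simp only [select, Set.mem_union, Set.mem_ofPred_eq, ih v h0, hA t v h0]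
    have h2 : (∀ w ∈ D, v + w ∉ select D A t) ↔ ∀ w ∈ D, v + w ∉ select D A' t :=
      forall₂_congr fun w hw => not_congr (h1 w hw)
    rw [h2]

theorem select_shift {A A' : ℕ → Set (Site d)} {u : Site d}
    (h : ∀ t v, v ∈ A' t ↔ v - u ∈ A t) (t : ℕ) :
    ∀ v, v ∈ select D A' t ↔ v - u ∈ select D A t := by
  induction t with
  | zero => intro v; rfl
  | succ t ih =>
    intro v
    have e : ∀ w, v + w - u = v - u + w := fun w => by abel
    simp only [select, Set.mem_union, Set.mem_ofPred_eq, ih, h, e]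

theorem greedy_shift {A A' : ℕ → Set (Site d)} {u : Site d}
    (h : ∀ t v, v ∈ A' t ↔ v - u ∈ A t) (v : Site d) :
    v ∈ greedy D A' ↔ v - u ∈ greedy D A := by
  simp only [greedy, Set.mem_iUnion, select_shift h]

end Greedy

/-! ### Color reduction and the net -/

section Reduction

variable {d : ℕ} {D : Finset (Site d)}

/-- Palettes of `2 ^ size j` colors such that the `D`-indexed families of a bit position and a bit
of the palette `j + 1` can be encoded in the palette `j`. -/
structure Palettes (D : Finset (Site d)) where
  size : ℕ → ℕ
  pos : ∀ j, 0 < size j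
  code : ∀ j, (D → Fin (size (j + 1)) × Bool) ↪ (Fin (size j) → Bool)

/-- A position at which two different bit strings differ. -/
noncomputable def diffPos {n : ℕ} (hn : 0 < n) (a b : Fin n → Bool) : Fin n :=
  open scoped Classical in if h : ∃ i, a i ≠ b i then h.choose else ⟨0, hn⟩

theorem diffPos_spec {n : ℕ} (hn : 0 < n) {a b : Fin n → Bool} (h : a ≠ b) :
    a (diffPos hn a b) ≠ b (diffPos hn a b) := by
  have h' : ∃ i, a i ≠ b i := Function.ne_iff.1 h
  rw [diffPos, dif_pos h']
  exact h'.choose_spec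

namespace Palettes

variable (p : Palettes D)

/-- The new color of a site with color `a`, given the colors `b` of its neighbours: for each
neighbour, a position where the two colors differ, together with the own bit there. -/
noncomputable def newColor (j : ℕ) (a : Fin (p.size (j + 1)) → Bool)
    (b : D → Fin (p.size (j + 1)) → Bool) : Fin (p.size j) → Bool :=
  p.code j fun w => (diffPos (p.pos _) a (b w), a (diffPos (p.pos _) a (b w)))

/-- One round of color reduction. -/
noncomputable def reduceStep (j : ℕ) (c : Site d → Fin (p.size (j + 1)) → Bool) :
    Site d → Fin (p.size j) → Bool :=
  fun v => p.newColor j (c v) fun w => c (v + w)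

/-- Color reduction from the palette `j` to the palette `0`. -/
noncomputable def reduce : (j : ℕ) → (Site d → Fin (p.size j) → Bool) →
    Site d → Fin (p.size 0) → Bool
  | 0, c => c
  | j + 1, c => reduce j (p.reduceStep j c)

/-- Equal new colors would record, at the same index `w`, the same position and the same bit for
both sites, but at the position recorded by `v` their bits differ. Only this pair has to differ
beforehand, so the reduction also works where the coloring is proper only in places. -/
theorem reduceStep_ne {j : ℕ} {c : Site d → Fin (p.size (j + 1)) → Bool} {v w : Site d}
    (hw : w ∈ D) (h : c v ≠ c (v + w)) : p.reduceStep j c v ≠ p.reduceStep j c (v + w) := by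
  intro he
  have h1 := congrFun ((p.code j).injective he) ⟨w, hw⟩
  have h2 := congrArg Prod.fst h1
  have h3 := congrArg Prod.snd h1
  simp only at h2 h3
  rw [← h2] at h3
  exact diffPos_spec (p.pos _) h h3

theorem reduce_ne {w : Site d} (hw : w ∈ D) (j : ℕ) :
    ∀ (c : Site d → Fin (p.size j) → Bool) (v : Site d), c v ≠ c (v + w) →
      p.reduce j c v ≠ p.reduce j c (v + w) := by
  induction j with
  | zero => intro c v h; exact h
  | succ j ih => intro c v h; exact ih _ _ (p.reduceStep_ne hw h)

theorem reduce_congr {ρ R : ℕ} (hρ : ∀ w ∈ D, norm1 w ≤ ρ) (j : ℕ) :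
    ∀ (r : ℕ) (c c' : Site d → Fin (p.size j) → Bool), (∀ v, norm1 v + r ≤ R → c v = c' v) →
      ∀ v, norm1 v + (r + ρ * j) ≤ R → p.reduce j c v = p.reduce j c' v := by
  induction j with
  | zero => intro r c c' h v hv; exact h v (by simpa using hv)
  | succ j ih =>
    intro r c c' h v hv
    refine ih (r + ρ) _ _ (fun v hv => ?_) v (by rw [mul_add] at hv; omega)
    rw [reduceStep, reduceStep, h v (by omega)]
    congr 1
    funext w
    refine h _ ?_
    have := norm1_add_le v w
    have := hρ w w.2
    omega

theorem reduce_shift {u : Site d} (j : ℕ) :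
    ∀ (c c' : Site d → Fin (p.size j) → Bool), (∀ v, c' v = c (v - u)) →
      ∀ v, p.reduce j c' v = p.reduce j c (v - u) := by
  induction j with
  | zero => intro c c' h v; exact h v
  | succ j ih =>
    intro c c' h v
    refine ih _ _ (fun v => ?_) v
    have e : ∀ w, v + w - u = v - u + w := fun w => by abel
    simp only [reduceStep, h, e]

/-- The number of colors of the smallest palette. -/
def numColors : ℕ := Fintype.card (Fin (p.size 0) → Bool)

theorem numColors_pos : 0 < p.numColors := Fintype.card_pos

/-- At level `j` the site `v` has a color different from those of all its neighbours. -/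
def Fresh (c : ∀ j, Site d → Fin (p.size j) → Bool) (j : ℕ) (v : Site d) : Prop :=
  ∀ w ∈ D, c j (v + w) ≠ c j v

/-- The sites treated by the greedy algorithm at time `j * numColors + k`: those of level `j`
whose reduced color is `k`. -/
def stage (c : ∀ j, Site d → Fin (p.size j) → Bool) (t : ℕ) : Set (Site d) :=
  {v | p.Fresh c (t / p.numColors) v ∧ (∀ i < t / p.numColors, ¬ p.Fresh c i v) ∧
    (Fintype.equivFin _ (p.reduce (t / p.numColors) (c (t / p.numColors)) v) : ℕ) =
      t % p.numColors}

theorem stage_unique (c : ∀ j, Site d → Fin (p.size j) → Bool) (v : Site d) (t t' : ℕ)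
    (h : v ∈ p.stage c t) (h' : v ∈ p.stage c t') : t = t' := by
  obtain ⟨h1, h2, h3⟩ := h
  obtain ⟨h1', h2', h3'⟩ := h'
  have e : t / p.numColors = t' / p.numColors := by
    rcases lt_trichotomy (t / p.numColors) (t' / p.numColors) with h | h | h
    · exact (h2' _ h h1).elim
    · exact h
    · exact (h2 _ h h1').elim
  rw [e, h3'] at h3
  rw [← Nat.div_add_mod t p.numColors, ← Nat.div_add_mod t' p.numColors, e, h3]

/-- Sites treated together have the same level, at which both are fresh, so neighbours start with
different colors and reduction keeps them different. -/
theorem stage_proper (c : ∀ j, Site d → Fin (p.size j) → Bool) (v : Site d) (t : ℕ)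
    (h : v ∈ p.stage c t) (w : Site d) (hw : w ∈ D) : v + w ∉ p.stage c t := by
  intro h'
  have h3 := h.2.2.trans h'.2.2.symm
  refine p.reduce_ne hw _ _ v (h.1 w hw).symm ?_
  exact (Fintype.equivFin _).injective (Fin.ext h3)

theorem exists_mem_stage {c : ∀ j, Site d → Fin (p.size j) → Bool} {v : Site d} {j : ℕ}
    (h : p.Fresh c j v) : ∃ t < (j + 1) * p.numColors, v ∈ p.stage c t := by
  classical
  have hex : ∃ i, p.Fresh c i v := ⟨j, h⟩
  set i := Nat.find hex with hi
  have hij : i ≤ j := Nat.find_min' hex h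
  set k := Fintype.equivFin _ (p.reduce i (c i) v) with hk
  have hkN : (k : ℕ) < p.numColors := k.2
  have hdiv : (i * p.numColors + k) / p.numColors = i := by
    rw [mul_comm, Nat.mul_add_div p.numColors_pos, Nat.div_eq_of_lt hkN, add_zero]
  have hmod : (i * p.numColors + k) % p.numColors = k := by
    rw [mul_comm, Nat.mul_add_mod, Nat.mod_eq_of_lt hkN]
  refine ⟨i * p.numColors + k, by nlinarith, ?_⟩
  rw [stage, Set.mem_ofPred_eq, hdiv, hmod]
  exact ⟨Nat.find_spec hex, fun l hl => Nat.find_min hex hl, rfl⟩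

theorem stage_congr {ρ R : ℕ} (hρ : ∀ w ∈ D, norm1 w ≤ ρ)
    {c c' : ∀ j, Site d → Fin (p.size j) → Bool} (h : ∀ j v, norm1 v ≤ R → c j v = c' j v)
    (t : ℕ) (v : Site d) (hv : norm1 v + ρ * (t + 1) ≤ R) :
    v ∈ p.stage c t ↔ v ∈ p.stage c' t := by
  have hf : ∀ j, p.Fresh c j v ↔ p.Fresh c' j v := by
    intro j
    refine forall₂_congr fun w hw => ?_
    have h1 := norm1_add_le v w
    have h2 := hρ w hw
    rw [h j v (by omega), h j (v + w) (by nlinarith)]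
  have hr : p.reduce (t / p.numColors) (c (t / p.numColors)) v =
      p.reduce (t / p.numColors) (c' (t / p.numColors)) v := by
    refine p.reduce_congr (R := R) hρ _ 0 _ _ (fun v hv => h _ v (by omega)) v ?_
    have h1 : t / p.numColors ≤ t + 1 := (Nat.div_le_self _ _).trans (by omega)
    have h2 := Nat.mul_le_mul_left ρ h1
    omega
  simp only [stage, Set.mem_ofPred_eq, hf, hr]

theorem stage_shift {u : Site d} {c c' : ∀ j, Site d → Fin (p.size j) → Bool}
    (h : ∀ j v, c' j v = c j (v - u)) (t : ℕ) (v : Site d) :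
    v ∈ p.stage c' t ↔ v - u ∈ p.stage c t := by
  have e : ∀ w, v + w - u = v - u + w := fun w => by abel
  simp only [stage, Set.mem_ofPred_eq, Fresh, h, e, p.reduce_shift _ (c _) (c' _) (h _)]

/-- The net constructed from the colors `c`. -/
def net (c : ∀ j, Site d → Fin (p.size j) → Bool) : Set (Site d) := greedy D (p.stage c)

theorem isNet_net (hsymm : ∀ w ∈ D, -w ∈ D) {c : ∀ j, Site d → Fin (p.size j) → Bool}
    (h : ∀ v, ∃ j, p.Fresh c j v) : IsNet D (p.net c) :=
  isNet_greedy hsymm (p.stage_proper c) fun v => by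
    obtain ⟨j, hj⟩ := h v
    obtain ⟨t, _, ht⟩ := p.exists_mem_stage hj
    exact ⟨t, ht⟩

/-- A site fresh at level `j` is treated before time `(j + 1) * numColors`, and each time step costs
distance `ρ`. Freshness is required only at `v`: other sites, still untreated by then, have no
influence. -/
theorem net_congr {ρ R : ℕ} (hρ : ∀ w ∈ D, norm1 w ≤ ρ)
    {c c' : ∀ j, Site d → Fin (p.size j) → Bool} (h : ∀ j v, norm1 v ≤ R → c j v = c' j v)
    {j : ℕ} {v : Site d} (hj : p.Fresh c j v)
    (hv : norm1 v + ρ * ((j + 1) * p.numColors + 1) ≤ R) : v ∈ p.net c ↔ v ∈ p.net c' := by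
  obtain ⟨t, ht, hvt⟩ := p.exists_mem_stage hj
  have h1 : norm1 v + ρ * (t + 1 + 1) ≤ R :=
    (Nat.add_le_add_left (Nat.mul_le_mul_left ρ (by omega)) _).trans hv
  have hvt' := (p.stage_congr hρ h t v (by nlinarith)).1 hvt
  rw [net, net, mem_greedy_iff (p.stage_unique c) hvt, mem_greedy_iff (p.stage_unique c') hvt']
  exact select_congr hρ (p.stage_congr hρ h) (t + 1) v h1

end Palettes

end Reduction

/-! ### Palettes of tower size -/

section PaletteSizes

/-- Since `E * log 2 ≥ 1`, the power `2 ^ m` is at least `2 ^ E * exp (t - 1)`, and the factor `2 ^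
E` pays for all constants. -/
theorem exp_bound {K E : ℕ} (hE : 2 ≤ E) (hKE : 16 * K * E ≤ 2 ^ E) {t : ℝ} (ht : 1 ≤ t) {m : ℕ}
    (hm : E * t ≤ m) : 4 * K * E * Real.exp t ≤ 2 ^ m := by
  have hlog := Real.log_two_gt_d9
  have hE' : (2 : ℝ) ≤ E := by exact_mod_cast hE
  have h1 : (2 : ℝ) ^ E * Real.exp (t - 1) ≤ 2 ^ m := by
    have e : ∀ n : ℕ, (2 : ℝ) ^ n = Real.exp (n * Real.log 2) := fun n => by
      rw [Real.exp_nat_mul, Real.exp_log two_pos]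
    rw [e, e, ← Real.exp_add, Real.exp_le_exp]
    have h2 : (E : ℝ) * (t - 1) * Real.log 2 ≤ (m - E) * Real.log 2 := by
      gcongr; linarith
    have h3 : (t - 1) * 1 ≤ (t - 1) * (E * Real.log 2) := by
      refine mul_le_mul_of_nonneg_left ?_ (by linarith)
      nlinarith
    nlinarith
  refine le_trans ?_ h1
  have h4 : Real.exp t = Real.exp 1 * Real.exp (t - 1) := by
    rw [← Real.exp_add]; ring_nf
  have h5 := Real.exp_one_lt_d9
  have h6 : (16 * K * E : ℝ) ≤ 2 ^ E := by exact_mod_cast hKE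
  calc 4 * K * E * Real.exp t = 4 * K * E * Real.exp 1 * Real.exp (t - 1) := by rw [h4]; ring
    _ ≤ 4 * K * E * 4 * Real.exp (t - 1) := by gcongr; linarith
    _ = 16 * K * E * Real.exp (t - 1) := by ring
    _ ≤ _ := by gcongr

theorem exists_pow_bound (K H : ℕ) : ∃ E : ℕ, 2 ≤ E ∧ H ≤ E ∧ 16 * K * E ≤ 2 ^ E := by
  have h := tendsto_pow_const_div_const_pow_of_one_lt 1 (r := (2 : ℝ)) (by norm_num)
  have h1 : ∀ᶠ n : ℕ in Filter.atTop, (n : ℝ) ^ 1 / 2 ^ n < 1 / (16 * K + 1) :=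
    h.eventually_lt_const (by positivity)
  obtain ⟨E, hE, h2, h3⟩ := (h1.and ((Filter.eventually_ge_atTop 2).and
    (Filter.eventually_ge_atTop H))).exists
  refine ⟨E, h2, h3, ?_⟩
  rw [pow_one, div_lt_div_iff₀ (by positivity) (by positivity)] at hE
  have : (16 * K * E : ℝ) ≤ 2 ^ E := by
    have : (0 : ℝ) ≤ E := by positivity
    nlinarith
  exact_mod_cast this

/-- With `s j = K * m j` and `m (j + 1)` about `2 ^ m j / (2 * K)` the encoding condition holds by
construction. Starting from a large `E`, the invariant `E * tower j ≤ m j` survives the loss of the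
constant in every step. -/
theorem exists_sizes (k H : ℕ) : ∃ s : ℕ → ℕ, (∀ j, 0 < s j) ∧
    (∀ j, (2 * s (j + 1)) ^ k ≤ 2 ^ s j) ∧ ∀ j, H * tower j < 2 ^ s j := by
  set K := k + 1 with hK
  obtain ⟨E, hE2, hEH, hE⟩ := exists_pow_bound K H
  obtain ⟨m, hm0, hm1⟩ : ∃ m : ℕ → ℕ, m 0 = E ∧ ∀ j, m (j + 1) = 2 ^ m j / (2 * K) :=
    ⟨fun j => Nat.rec (motive := fun _ => ℕ) E (fun _ x => 2 ^ x / (2 * K)) j, rfl, fun _ => rfl⟩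
  have hEr : (2 : ℝ) ≤ E := by exact_mod_cast hE2
  have hKr : (1 : ℝ) ≤ K := by rw [hK]; push_cast; linarith [k.cast_nonneg (α := ℝ)]
  have hm : ∀ j, (E : ℝ) * tower j ≤ m j := by
    intro j
    induction j with
    | zero => simp [hm0, tower_zero]
    | succ j ih =>
      have h1 := exp_bound hE2 hE (one_le_tower j) ih
      have h2 : (2 : ℝ) ^ m j ≤ 2 * K * (m (j + 1) + 1) := by
        have h3 : 2 ^ m j < (2 * K) * (2 ^ m j / (2 * K) + 1) :=
          Nat.lt_mul_div_succ _ (by omega)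
        rw [← hm1] at h3
        exact_mod_cast h3.le
      have h4 := Real.add_one_le_exp (tower j)
      have h5 := one_le_tower j
      rw [tower_succ]
      -- The spare factor 2 pays for the rounding in the division.
      have h6 : 2 * (E * Real.exp (tower j)) ≤ m (j + 1) + 1 := by
        by_contra! hc
        have : 2 * K * ((m (j + 1) : ℝ) + 1) < 2 * K * (2 * (E * Real.exp (tower j))) := by gcongr
        nlinarith
      nlinarith
  have hmpos : ∀ j, 1 ≤ m j := fun j => by
    have h1 := hm j
    have h2 := one_le_tower j
    have : (1 : ℝ) ≤ m j := by nlinarith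
    exact_mod_cast this
  refine ⟨fun j => K * m j, fun j => Nat.mul_pos (by omega) (hmpos j), fun j => ?_, fun j => ?_⟩
  · calc (2 * (K * m (j + 1))) ^ k = ((2 * K) * m (j + 1)) ^ k := by ring
      _ ≤ (2 ^ m j) ^ k := by
        gcongr
        rw [hm1]
        exact Nat.mul_div_le _ _
      _ = 2 ^ (m j * k) := by rw [pow_mul]
      _ ≤ 2 ^ (K * m j) := Nat.pow_le_pow_right (by omega) (by rw [hK]; nlinarith)
  · have h1 : (H : ℝ) * tower j ≤ m j := by
      refine le_trans ?_ (hm j)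
      have := tower_pos j
      gcongr
    have h2 : m j ≤ K * m j := Nat.le_mul_of_pos_left _ (by omega)
    have h3 : K * m j < 2 ^ (K * m j) := Nat.lt_two_pow_self
    refine h1.trans_lt ?_
    exact_mod_cast h2.trans_lt h3

theorem exists_palettes {d : ℕ} (D : Finset (Site d)) (H : ℕ) :
    ∃ p : Palettes D, ∀ j, H * tower j < 2 ^ p.size j := by
  obtain ⟨s, h1, h2, h3⟩ := exists_sizes D.card H
  have h4 : ∀ j, Nonempty ((D → Fin (s (j + 1)) × Bool) ↪ (Fin (s j) → Bool)) := fun j => by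
    rw [Function.Embedding.nonempty_iff_card_le]
    simpa [mul_comm] using h2 j
  exact ⟨⟨s, h1, fun j => (h4 j).some⟩, h3⟩

end PaletteSizes

/-! ### Random bits from uniform variables -/

section Bits

/-- The first `n` binary digits of a number in `[0, 1)`. -/
noncomputable def bits (n : ℕ) (x : ℝ) : Fin n → Bool := fun i => Nat.testBit ⌊2 ^ n * x⌋₊ i

theorem measurable_bits (n : ℕ) : Measurable (bits n) :=
  measurable_pi_lambda _ fun i => (Measurable.of_discrete (f := fun m : ℕ => m.testBit i)).comp
    (Nat.measurable_floor.comp (by fun_prop))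

/-- The uniform distribution on the unit interval. -/
noncomputable def unif : Measure ℝ := volume.restrict (Set.Ico 0 1)

instance : IsProbabilityMeasure unif := ⟨by simp [unif]⟩

theorem floor_eq_of_bits_eq {n : ℕ} {x y : ℝ} (hx : x ∈ Set.Ico (0 : ℝ) 1)
    (hy : y ∈ Set.Ico (0 : ℝ) 1) (h : bits n x = bits n y) :
    ⌊(2 : ℝ) ^ n * x⌋₊ = ⌊(2 : ℝ) ^ n * y⌋₊ := by
  have hlt : ∀ z ∈ Set.Ico (0 : ℝ) 1, ⌊(2 : ℝ) ^ n * z⌋₊ < 2 ^ n := fun z hz => by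
    rw [Nat.floor_lt (mul_nonneg (by positivity) hz.1)]
    push_cast
    have : (0 : ℝ) < 2 ^ n := by positivity
    nlinarith [hz.2]
  refine Nat.eq_of_testBit_eq fun i => ?_
  by_cases hi : i < n
  · exact congrFun h ⟨i, hi⟩
  · have hp : 2 ^ n ≤ 2 ^ i := Nat.pow_le_pow_right (by omega) (by omega)
    rw [Nat.testBit_eq_false_of_lt ((hlt x hx).trans_le hp),
      Nat.testBit_eq_false_of_lt ((hlt y hy).trans_le hp)]

theorem unif_bits_eq_le (n : ℕ) (a : Fin n → Bool) :
    unif {x | bits n x = a} ≤ ((2 : ℝ≥0∞) ^ n)⁻¹ := by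
  rw [unif, Measure.restrict_apply (s := Set.Ico 0 1) (t := {x | bits n x = a})
    (measurable_bits n (measurableSet_singleton a))]
  rcases Set.eq_empty_or_nonempty ({x | bits n x = a} ∩ Set.Ico (0 : ℝ) 1) with h | ⟨x₀, h0, h0'⟩
  · rw [h]; simp
  · set m := ⌊(2 : ℝ) ^ n * x₀⌋₊ with hm
    have hsub : {x | bits n x = a} ∩ Set.Ico (0 : ℝ) 1 ⊆
        Set.Ico ((m : ℝ) / 2 ^ n) ((m + 1) / 2 ^ n) := by
      rintro x ⟨hx, hx'⟩
      have e := floor_eq_of_bits_eq hx' h0' (Eq.trans hx (Eq.symm h0))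
      rw [← hm] at e
      have h1 := Nat.floor_le (mul_nonneg (pow_nonneg zero_le_two n) hx'.1 : (0:ℝ) ≤ 2 ^ n * x)
      have h2 := Nat.lt_floor_add_one ((2 : ℝ) ^ n * x)
      rw [e] at h1 h2
      constructor
      · rw [div_le_iff₀ (by positivity)]; linarith
      · rw [lt_div_iff₀ (by positivity)]; linarith
    refine (measure_mono hsub).trans ?_
    rw [Real.volume_Ico, ← sub_div, add_sub_cancel_left, one_div,
      ENNReal.ofReal_inv_of_pos (by positivity), ENNReal.ofReal_pow (by norm_num)]
    simp

theorem measure_bits_collision_le {ι : Type*} {u v : ι} (huv : u ≠ v) (n : ℕ) :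
    (Measure.infinitePi fun _ : ι => unif) {y | bits n (y u) = bits n (y v)} ≤
      ((2 : ℝ≥0∞) ^ n)⁻¹ := by
  have hm : MeasurableSet {p : ℝ × ℝ | bits n p.1 = bits n p.2} :=
    measurableSet_eq_fun ((measurable_bits n).comp measurable_fst)
      ((measurable_bits n).comp measurable_snd)
  have e := Measure.infinitePi_map_eval_prod (P := fun _ : ι => unif) huv
  have h1 : (Measure.infinitePi fun _ : ι => unif) {y | bits n (y u) = bits n (y v)} =
      (unif.prod unif) {p : ℝ × ℝ | bits n p.1 = bits n p.2} := by
    rw [← e, Measure.map_apply (by fun_prop) hm]; rfl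
  rw [h1, Measure.prod_apply hm]
  calc _ ≤ ∫⁻ _, ((2 : ℝ≥0∞) ^ n)⁻¹ ∂unif := by
        refine lintegral_mono fun x => ?_
        refine le_trans (measure_mono fun y hy => ?_) (unif_bits_eq_le n (bits n x))
        exact Eq.symm hy
    _ = _ := by simp

end Bits

/-! ### The net as a finitary factor -/

namespace Palettes

variable {d : ℕ} {D : Finset (Site d)} (p : Palettes D)

/-- The colors at all levels read off from a configuration of real numbers. -/
noncomputable def colors (y : Site d → ℝ) (j : ℕ) (v : Site d) : Fin (p.size j) → Bool :=
  bits (p.size j) (y v)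

theorem measurable_colors (j : ℕ) (v : Site d) : Measurable fun y => p.colors y j v :=
  (measurable_bits _).comp (measurable_pi_apply v)

theorem measurable_reduce {Ω : Type*} [MeasurableSpace Ω] (j : ℕ) :
    ∀ (c : Ω → Site d → Fin (p.size j) → Bool), (∀ v, Measurable fun y => c y v) →
      ∀ v, Measurable fun y => p.reduce j (c y) v := by
  induction j with
  | zero => intro c hc v; exact hc v
  | succ j ih =>
    intro c hc v
    refine ih (fun y => p.reduceStep j (c y)) (fun v => ?_) v
    have h1 : Measurable fun y => (c y v, fun w : D => c y (v + w)) :=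
      (hc v).prodMk (measurable_pi_lambda _ fun w => hc (v + w))
    exact (Measurable.of_discrete (f := fun q : (Fin (p.size (j + 1)) → Bool) ×
      (D → Fin (p.size (j + 1)) → Bool) => p.newColor j q.1 q.2)).comp h1

theorem measurableSet_fresh (j : ℕ) (v : Site d) :
    MeasurableSet {y | p.Fresh (p.colors y) j v} := by
  have : {y | p.Fresh (p.colors y) j v} =
      ⋂ w ∈ D, {y | p.colors y j (v + w) = p.colors y j v}ᶜ := by
    ext y; simp [Fresh]
  rw [this]
  exact Finset.measurableSet_biInter _ fun w _ =>
    (measurableSet_eq_fun (p.measurable_colors j _) (p.measurable_colors j v)).compl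

theorem measurableSet_mem_stage (t : ℕ) (v : Site d) :
    MeasurableSet {y | v ∈ p.stage (p.colors y) t} := by
  have : {y | v ∈ p.stage (p.colors y) t} =
      {y | p.Fresh (p.colors y) (t / p.numColors) v} ∩
        ((⋂ i ∈ Finset.range (t / p.numColors), {y | p.Fresh (p.colors y) i v}ᶜ) ∩
        (fun y => p.reduce (t / p.numColors) (p.colors y (t / p.numColors)) v) ⁻¹'
          {a | (Fintype.equivFin _ a : ℕ) = t % p.numColors}) := by
    ext y; simp [stage]
  rw [this]
  refine (p.measurableSet_fresh _ v).inter (MeasurableSet.inter ?_ ?_)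
  · exact Finset.measurableSet_biInter _ fun i _ => (p.measurableSet_fresh i v).compl
  · exact p.measurable_reduce _ (fun y => p.colors y _) (p.measurable_colors _) v
      (MeasurableSet.of_discrete)

theorem measurableSet_mem_select (t : ℕ) :
    ∀ v, MeasurableSet {y | v ∈ select D (p.stage (p.colors y)) t} := by
  induction t with
  | zero => intro v; exact MeasurableSet.empty
  | succ t ih =>
    intro v
    have : {y | v ∈ select D (p.stage (p.colors y)) (t + 1)} =
        {y | v ∈ select D (p.stage (p.colors y)) t} ∪ ({y | v ∈ p.stage (p.colors y) t} ∩
          ⋂ w ∈ D, {y | v + w ∈ select D (p.stage (p.colors y)) t}ᶜ) := by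
      ext y; simp [select]
    rw [this]
    exact (ih v).union ((p.measurableSet_mem_stage t v).inter
      (Finset.measurableSet_biInter _ fun w _ => (ih _).compl))

theorem measurableSet_mem_net (v : Site d) : MeasurableSet {y | v ∈ p.net (p.colors y)} := by
  have : {y | v ∈ p.net (p.colors y)} = ⋃ t, {y | v ∈ select D (p.stage (p.colors y)) t} := by
    ext y; simp [net, greedy]
  rw [this]
  exact MeasurableSet.iUnion fun t => p.measurableSet_mem_select t v

/-- A union bound over the pairs `v`, `v + w`, which are distinct sites because `0 ∉ D`. -/
theorem measure_not_fresh_le (h0 : 0 ∉ D) (j : ℕ) (S : Finset (Site d)) :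
    (Measure.infinitePi fun _ : Site d => unif) {y | ∃ v ∈ S, ¬ p.Fresh (p.colors y) j v} ≤
      S.card * D.card * ((2 : ℝ≥0∞) ^ p.size j)⁻¹ := by
  have : {y | ∃ v ∈ S, ¬ p.Fresh (p.colors y) j v} =
      ⋃ v ∈ S, ⋃ w ∈ D, {y | p.colors y j (v + w) = p.colors y j v} := by
    ext y; simp [Fresh]
  rw [this]
  refine (measure_biUnion_finset_le _ _).trans ?_
  calc _ ≤ ∑ v ∈ S, D.card * ((2 : ℝ≥0∞) ^ p.size j)⁻¹ := by
        refine Finset.sum_le_sum fun v _ => (measure_biUnion_finset_le _ _).trans ?_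
        calc _ ≤ ∑ w ∈ D, ((2 : ℝ≥0∞) ^ p.size j)⁻¹ := by
              refine Finset.sum_le_sum fun w hw => measure_bits_collision_le ?_ _
              intro h
              have : w = 0 := by simpa using h
              exact h0 (this ▸ hw)
          _ = _ := by simp
    _ = _ := by simp [mul_assoc]

/-- The factor map that evaluates a local function of the net. -/
noncomputable def factorMap {A : Type*} (G : Set (Site d) → A) (y : Site d → ℝ) : Site d → A :=
  fun v => G {u | v + u ∈ p.net (p.colors y)}

theorem isFactorMap_factorMap {A : Type*} [MeasurableSpace A] {G : Set (Site d) → A}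
    {S : Finset (Site d)} (hG : ∀ M M' : Set (Site d), (∀ u ∈ S, u ∈ M ↔ u ∈ M') → G M = G M') :
    IsFactorMap (p.factorMap G) := by
  constructor
  · refine measurable_pi_lambda _ fun v => ?_
    have h1 : Measurable fun y => fun u : S => v + (u : Site d) ∈ p.net (p.colors y) :=
      measurable_pi_lambda _ fun u => measurableSet_setOfPred.1 (p.measurableSet_mem_net _)
    -- Locality of `G` factors the map through the finite type `S → Prop`, where every function is
    -- measurable.
    have h2 : (fun y => p.factorMap G y v) =
        (fun b : S → Prop => G {u | ∃ h : u ∈ S, b ⟨u, h⟩}) ∘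
          fun y => fun u : S => v + (u : Site d) ∈ p.net (p.colors y) := by
      funext y
      refine hG _ _ fun u hu => ?_
      simp [hu]
    rw [h2]
    exact Measurable.of_discrete.comp h1
  · intro u y
    funext v
    have h1 : ∀ w, w ∈ p.net (p.colors (translate u y)) ↔ w - u ∈ p.net (p.colors y) :=
      greedy_shift (p.stage_shift fun j v => rfl)
    have e : ∀ w, v + w - u = v - u + w := fun w => by abel
    simp only [factorMap, translate, h1, e]

theorem determines_factorMap {A : Type*} {G : Set (Site d) → A}
    {S : Finset (Site d)} (hG : ∀ M M' : Set (Site d), (∀ u ∈ S, u ∈ M ↔ u ∈ M') → G M = G M')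
    {ρ k : ℕ} (hρ : ∀ w ∈ D, norm1 w ≤ ρ) (hk : ∀ v ∈ S, norm1 v ≤ k) {y : Site d → ℝ} {j : ℕ}
    (hj : ∀ v ∈ S, p.Fresh (p.colors y) j v) :
    Determines (p.factorMap G) y (k + ρ * ((j + 1) * p.numColors + 1)) := by
  intro y' hy'
  refine hG _ _ fun u hu => ?_
  simp only [zero_add, Set.mem_ofPred_eq]
  refine (p.net_congr hρ (fun i v hv => ?_) (hj u hu) (Nat.add_le_add_right (hk u hu) _)).symm
  simp only [colors]
  rw [hy' v hv]

end Palettes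

/-! ### From local rules on nets to the upper bound -/

theorem IsNet.shift {d : ℕ} {D : Finset (Site d)} {M : Set (Site d)} (h : IsNet D M)
    (v : Site d) : IsNet D {u | v + u ∈ M} := by
  constructor
  · intro u hu w hw huw
    exact h.sep hu w hw (by simpa [add_assoc] using huw)
  · intro u hu
    obtain ⟨w, hw, h'⟩ := h.dom hu
    exact ⟨w, hw, by simpa [add_assoc] using h'⟩

/-- If all sites of the window `S` are fresh at level `n`, the color is determined within distance
linear in `n`; failure has probability below `1 / tower n`. -/
theorem exists_radiusTail_le {d q : ℕ} {D : Finset (Site d)} (h0 : 0 ∉ D)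
    (hsymm : ∀ w ∈ D, -w ∈ D) {G : Set (Site d) → Fin q} {S : Finset (Site d)}
    (hG : ∀ M M' : Set (Site d), (∀ u ∈ S, u ∈ M ↔ u ∈ M') → G M = G M')
    (hproper : ∀ M, IsNet D M → ∀ e, norm1 e = 1 → G M ≠ G {u | e + u ∈ M}) :
    ∃ c : ℝ, 0 < c ∧
      ∃ (Ω : Type) (_ : MeasurableSpace Ω) (P : Measure Ω) (_ : IsProbabilityMeasure P)
        (Y : Site d → Ω → ℝ) (F : (Site d → ℝ) → (Site d → Fin q)) (X : Ω → Site d → Fin q),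
        IsFFIID P Y F X ∧ IsColoring P X ∧
        ∀ r : ℝ, 0 ≤ r →
          radiusTail P Y F r ≤ 1 / towerReal (c * r) ∧
          (1 ≤ c * r → radiusTail P Y F r < 1 / towerReal (c * r)) := by
  -- The product beats the union bound over `S`; the `+ 1` keeps the palettes growing even if it
  -- vanishes, as almost sure freshness requires.
  obtain ⟨p, hp⟩ := exists_palettes D (S.card * D.card + 1)
  set ν := Measure.infinitePi fun _ : Site d => unif with hν
  set ρ := D.sup norm1 with hρ_def
  have hρ : ∀ w ∈ D, norm1 w ≤ ρ := fun w hw => Finset.le_sup (f := norm1) hw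
  set k := S.sup norm1 with hk_def
  have hk : ∀ v ∈ S, norm1 v ≤ k := fun v hv => Finset.le_sup (f := norm1) hv
  have hsize : ∀ j, tower j < 2 ^ p.size j := fun j => by
    refine lt_of_le_of_lt ?_ (hp j)
    have := tower_pos j
    push_cast
    nlinarith [(by positivity : (0 : ℝ) ≤ S.card * D.card)]
  have hbad : ∀ (T : Finset (Site d)) (j : ℕ),
      ν.real {y | ∃ v ∈ T, ¬ p.Fresh (p.colors y) j v} ≤ T.card * D.card / 2 ^ p.size j := by
    intro T j
    have := ENNReal.toReal_mono (by finiteness) (p.measure_not_fresh_le h0 j T)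
    simpa [measureReal_def, div_eq_mul_inv] using this
  have hnull : ∀ T : Finset (Site d), ∀ᵐ y ∂ν, ∃ j, ∀ v ∈ T, p.Fresh (p.colors y) j v := by
    intro T
    rw [ae_iff, ← measureReal_eq_zero_iff]
    refine le_antisymm ?_ measureReal_nonneg
    refine le_of_forall_pos_le_add fun ε hε => ?_
    obtain ⟨j, hj⟩ := exists_nat_gt (T.card * D.card / ε)
    have h1 : ν.real {y | ¬ ∃ j, ∀ v ∈ T, p.Fresh (p.colors y) j v} ≤
        ν.real {y | ∃ v ∈ T, ¬ p.Fresh (p.colors y) j v} := by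
      refine measureReal_mono fun y hy => ?_
      simp only [Set.mem_ofPred_eq, not_exists, not_forall] at hy ⊢
      obtain ⟨v, hv, h⟩ := hy j
      exact ⟨v, hv, h⟩
    refine h1.trans ((hbad T j).trans ?_)
    rw [zero_add, div_le_iff₀ (by positivity)]
    rw [div_lt_iff₀ hε] at hj
    have h2 := natCast_add_one_le_tower j
    have h3 := hsize j
    nlinarith
  have hnet : ∀ᵐ y ∂ν, IsNet D (p.net (p.colors y)) := by
    have h1 : ∀ᵐ y ∂ν, ∀ v, ∃ j, p.Fresh (p.colors y) j v := by
      rw [ae_all_iff]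
      intro v
      filter_upwards [hnull {v}] with y ⟨j, hj⟩
      exact ⟨j, hj v (by simp)⟩
    filter_upwards [h1] with y hy
    exact p.isNet_net hsymm hy
  have hfactor := p.isFactorMap_factorMap hG
  have hconfig : config (fun (v : Site d) (y : Site d → ℝ) => y v) = id := rfl
  -- For `n ≥ 1` the radius `k + ρ * ((n + 1) * numColors + 1)` is at most `Λ * n`; the `+ 1` keeps
  -- `Λ` positive.
  set Λ : ℕ := 2 * (ρ * p.numColors) + ρ + k + 1 with hΛ
  refine ⟨1 / Λ, by positivity, Site d → ℝ, inferInstance, ν, inferInstance, fun v y => y v,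
    p.factorMap G, p.factorMap G, ⟨⟨fun v => measurable_pi_apply v, ?_, ?_⟩, hfactor, ?_, ?_⟩,
    ⟨hfactor.measurable, ?_⟩, ?_⟩
  · exact iIndepFun_infinitePi (P := fun _ : Site d => unif) (X := fun _ x => x)
      fun _ => measurable_id
  · intro u v
    refine ⟨(measurable_pi_apply u).aemeasurable, (measurable_pi_apply v).aemeasurable, ?_⟩
    rw [hν, Measure.infinitePi_map_eval (fun _ : Site d => unif),
      Measure.infinitePi_map_eval (fun _ : Site d => unif)]
  · exact Filter.Eventually.of_forall fun y => rfl
  · rw [hconfig, Measure.map_id]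
    filter_upwards [hnull S] with y ⟨j, hj⟩
    exact ne_top_of_le_ne_top (ENat.natCast_ne_top _)
      (codingRadius_le_of_determines (p.determines_factorMap hG hρ hk hj))
  · filter_upwards [hnet] with y hy u v huv he
    refine hproper _ (hy.shift v) (u - v) huv ?_
    refine Eq.trans (Eq.symm he) ?_
    simp only [Palettes.factorMap]
    congr 1
    ext w
    simp only [Set.mem_ofPred_eq]
    rw [show v + (u - v + w) = u + w by abel]
  · intro r hr
    have hstrict : 1 ≤ 1 / (Λ : ℝ) * r → radiusTail ν (fun (v : Site d) (y : Site d → ℝ) => y v)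
        (p.factorMap G) r < 1 / towerReal (1 / Λ * r) := by
      intro h1
      set n := ⌊1 / (Λ : ℝ) * r⌋₊ with hn
      have hn1 : 1 ≤ n := Nat.le_floor (by simpa using h1)
      have hnr : (Λ * n : ℝ) ≤ r := by
        have hΛpos : (0 : ℝ) < Λ := by positivity
        have := Nat.floor_le (show 0 ≤ 1 / (Λ : ℝ) * r by positivity)
        rw [← hn, one_div, ← div_eq_inv_mul, le_div_iff₀ hΛpos] at this
        linarith
      have hrad : ((k + ρ * ((n + 1) * p.numColors + 1) : ℕ) : ℝ) ≤ r := by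
        refine le_trans ?_ hnr
        have : k + ρ * ((n + 1) * p.numColors + 1) ≤ Λ * n := by
          calc k + ρ * ((n + 1) * p.numColors + 1)
              = (ρ * p.numColors) * n + (ρ * p.numColors + ρ + k) := by ring
            _ ≤ (ρ * p.numColors) * n + (ρ * p.numColors + ρ + k) * n := by
              gcongr; exact Nat.le_mul_of_pos_right _ hn1
            _ ≤ Λ * n := by rw [hΛ]; nlinarith
        exact_mod_cast this
      have h2 : radiusTail ν (fun (v : Site d) (y : Site d → ℝ) => y v) (p.factorMap G) r ≤
          S.card * D.card / 2 ^ p.size n := by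
        refine le_trans (measureReal_mono fun y hy => ?_) (hbad S n)
        simp only [Set.mem_ofPred_eq]
        by_contra! hc
        exact not_lt_codingRadius_of_determines hrad (p.determines_factorMap hG hρ hk hc) hy
      refine h2.trans_lt ?_
      have h3 := hp n
      have h4 : 0 < tower n := tower_pos n
      rw [towerReal, ← hn, div_lt_div_iff₀ (by positivity) h4]
      push_cast at h3
      nlinarith
    refine ⟨?_, hstrict⟩
    rcases lt_or_ge (1 / (Λ : ℝ) * r) 1 with h1 | h1
    · rw [towerReal, Nat.floor_eq_zero.2 h1, tower_zero, div_one]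
      exact measureReal_le_one
    · exact (hstrict h1).le

/-! ### Boxes and nets in the maximum norm -/

section Boxes

variable {d : ℕ}

/-- The sites all of whose coordinates have absolute value at most `r`. -/
noncomputable def box (d : ℕ) (r : ℤ) : Finset (Site d) := Fintype.piFinset fun _ => Finset.Icc (-r) r

theorem mem_box {r : ℤ} {v : Site d} : v ∈ box d r ↔ ∀ i, -r ≤ v i ∧ v i ≤ r := by
  simp [box]

/-- The connection set of the graph whose nets have mutual distances larger than `L`. -/
noncomputable def boxNeighbors (d : ℕ) (L : ℤ) : Finset (Site d) := (box d L).erase 0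

theorem IsNet.eq_of_sub_mem_box {L : ℤ} {M : Set (Site d)} (h : IsNet (boxNeighbors d L) M)
    {u v : Site d} (hu : u ∈ M) (hv : v ∈ M) (huv : u - v ∈ box d L) : u = v := by
  by_contra hne
  refine h.sep hv (u - v) (Finset.mem_erase.2 ⟨sub_ne_zero.2 hne, huv⟩) ?_
  rwa [add_sub_cancel]

theorem IsNet.exists_sub_mem_box {L : ℤ} (hL : 0 ≤ L) {M : Set (Site d)}
    (h : IsNet (boxNeighbors d L) M) (v : Site d) : ∃ u ∈ M, v - u ∈ box d L := by
  by_cases hv : v ∈ M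
  · exact ⟨v, hv, mem_box.2 fun i => by simpa using hL⟩
  · obtain ⟨w, hw, hvw⟩ := h.dom hv
    refine ⟨v + w, hvw, mem_box.2 fun i => ?_⟩
    have := mem_box.1 (Finset.mem_of_mem_erase hw) i
    simp only [sub_add_cancel_left, Pi.neg_apply]
    omega

theorem exists_single_of_norm1_eq_one {e : Site d} (he : norm1 e = 1) :
    ∃ i, (e i = 1 ∨ e i = -1) ∧ ∀ j, j ≠ i → e j = 0 := by
  obtain ⟨i, -, hi⟩ := Finset.exists_ne_zero_of_sum_ne_zero
    (show ∑ i, (e i).natAbs ≠ 0 by rw [← norm1, he]; exact one_ne_zero)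
  have h1 := Finset.add_sum_erase Finset.univ (fun i => (e i).natAbs) (Finset.mem_univ i)
  have h2 : ∑ i, (e i).natAbs = 1 := he
  simp only [h2] at h1
  refine ⟨i, by omega, fun j hj => ?_⟩
  have h3 : ∑ j ∈ Finset.univ.erase i, (e j).natAbs = 0 := by omega
  have := Finset.sum_eq_zero_iff.1 h3 j (by simp [hj])
  omega

theorem boundary_of_not_mem_box_iff {r : ℤ} {e x : Site d} {i : Fin d} (hi : e i = 1 ∨ e i = -1)
    (hj : ∀ j, j ≠ i → e j = 0) (h : ¬ (x ∈ box d r ↔ x + e ∈ box d r)) :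
    (e i = 1 ∧ (x i = r ∨ x i = -r - 1)) ∨ (e i = -1 ∧ (x i = -r ∨ x i = r + 1)) := by
  by_contra hc
  refine h ?_
  rw [mem_box, mem_box]
  refine forall_congr' fun j => ?_
  by_cases hji : j = i
  · subst hji
    simp only [Pi.add_apply]
    omega
  · simp [hj j hji]

end Boxes

/-! ### Radii avoiding common faces -/

section Radii

variable {d : ℕ}

/-- The box of radius `r` around the origin has no face in common with the boxes of radius `L`
around the nearby points of `M`. -/
def IsGoodRadius (L : ℤ) (M : Set (Site d)) (r : ℤ) : Prop :=
  L ≤ r ∧ r ≤ 2 * L ∧ ∀ u ∈ box d (3 * L + 1), u ∈ M →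
    ∀ i, r ≠ u i + L ∧ r ≠ u i - L - 1 ∧ r ≠ -u i - L - 1 ∧ r ≠ -u i + L

/-- A good radius if there is one. -/
noncomputable def goodRadius (L : ℤ) (M : Set (Site d)) : ℤ :=
  open scoped Classical in if h : ∃ r, IsGoodRadius L M r then h.choose else L

theorem isGoodRadius_goodRadius {L : ℤ} {M : Set (Site d)} (h : ∃ r, IsGoodRadius L M r) :
    IsGoodRadius L M (goodRadius L M) := by
  rw [goodRadius, dif_pos h]
  exact h.choose_spec

theorem goodRadius_mem {L : ℤ} (hL : 0 ≤ L) (M : Set (Site d)) :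
    L ≤ goodRadius L M ∧ goodRadius L M ≤ 2 * L := by
  by_cases h : ∃ r, IsGoodRadius L M r
  · have := isGoodRadius_goodRadius h
    exact ⟨this.1, this.2.1⟩
  · rw [goodRadius, dif_neg h]
    omega

theorem goodRadius_congr {L : ℤ} {M M' : Set (Site d)}
    (h : ∀ u ∈ box d (3 * L + 1), u ∈ M ↔ u ∈ M') : goodRadius L M = goodRadius L M' := by
  have : IsGoodRadius L M = IsGoodRadius L M' := by
    funext r
    have h1 : (∀ u ∈ box d (3 * L + 1), u ∈ M →
          ∀ i, r ≠ u i + L ∧ r ≠ u i - L - 1 ∧ r ≠ -u i - L - 1 ∧ r ≠ -u i + L) ↔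
        (∀ u ∈ box d (3 * L + 1), u ∈ M' →
          ∀ i, r ≠ u i + L ∧ r ≠ u i - L - 1 ∧ r ≠ -u i - L - 1 ∧ r ≠ -u i + L) :=
      forall₂_congr fun u hu => by rw [h u hu]
    simp only [IsGoodRadius, h1]
  exact congrArg (fun P : ℤ → Prop =>
    open scoped Classical in if h : ∃ r, P r then h.choose else L) this

/-- Cubes of side `L + 1` contain at most one net point each, and six of them per direction cover
the range from `-(3 * L + 1)` to `3 * L + 1`. -/
theorem IsNet.card_filter_box_le {L : ℤ} (hL : 0 ≤ L) {M : Set (Site d)}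
    (h : IsNet (boxNeighbors d L) M) [DecidablePred (· ∈ M)] :
    ((box d (3 * L + 1)).filter (· ∈ M)).card ≤ 6 ^ d := by
  have hcard : (Fintype.piFinset fun _ : Fin d => Finset.Icc (-3 : ℤ) 2).card = 6 ^ d := by
    simp
  rw [← hcard]
  refine Finset.card_le_card_of_injOn (fun u i => u i / (L + 1)) (fun u hu => ?_) ?_
  · rw [Finset.mem_coe, Finset.mem_filter, mem_box] at hu
    rw [Finset.mem_coe, Fintype.mem_piFinset]
    intro i
    have := hu.1 i
    rw [Finset.mem_Icc]
    constructor
    · rw [Int.le_ediv_iff_mul_le (by omega)]; omega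
    · rw [← Int.lt_add_one_iff, Int.ediv_lt_iff_lt_mul (by omega)]; omega
  · intro u hu v hv huv
    rw [Finset.mem_coe, Finset.mem_filter] at hu hv
    refine h.eq_of_sub_mem_box hu.2 hv.2 (mem_box.2 fun i => ?_)
    have h1 : u i / (L + 1) = v i / (L + 1) := congrFun huv i
    have h2 := Int.mul_ediv_add_emod (u i) (L + 1)
    have h3 := Int.mul_ediv_add_emod (v i) (L + 1)
    have h4 := Int.emod_nonneg (u i) (show L + 1 ≠ 0 by omega)
    have h5 := Int.emod_nonneg (v i) (show L + 1 ≠ 0 by omega)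
    have h6 := Int.emod_lt_of_pos (u i) (show 0 < L + 1 by omega)
    have h7 := Int.emod_lt_of_pos (v i) (show 0 < L + 1 by omega)
    rw [h1] at h2
    simp only [Pi.sub_apply]
    omega

/-- Each of at most `6 ^ d` net points forbids at most `4 * d` radii, fewer in total than the `L +
1` candidates. -/
theorem IsNet.exists_isGoodRadius {L : ℤ} {M : Set (Site d)}
    (hL : (6 ^ d * (d * 4) : ℕ) ≤ L) (h : IsNet (boxNeighbors d L) M) :
    ∃ r, IsGoodRadius L M r := by
  classical
  have hL0 : 0 ≤ L := le_trans (Int.natCast_nonneg _) hL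
  set U := (box d (3 * L + 1)).filter (· ∈ M) with hU
  let f : Site d → Finset ℤ := fun u => Finset.univ.biUnion fun i =>
    {u i + L, u i - L - 1, -u i - L - 1, -u i + L}
  have hf : ∀ u, (f u).card ≤ d * 4 := fun u => by
    simpa using Finset.card_biUnion_le_card_mul (Finset.univ : Finset (Fin d))
      (fun i => ({u i + L, u i - L - 1, -u i - L - 1, -u i + L} : Finset ℤ)) 4
      fun i _ => Finset.card_le_four
  have h1 : (U.biUnion f).card ≤ 6 ^ d * (d * 4) :=
    (Finset.card_biUnion_le_card_mul U f (d * 4) fun u _ => hf u).trans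
      (Nat.mul_le_mul_right _ (h.card_filter_box_le hL0))
  have h2 : (U.biUnion f).card < (Finset.Icc L (2 * L)).card := by
    rw [Int.card_Icc]
    omega
  obtain ⟨r, hr, hrf⟩ := Finset.exists_mem_notMem_of_card_lt_card h2
  rw [Finset.mem_Icc] at hr
  refine ⟨r, hr.1, hr.2, fun u hu huM i => ?_⟩
  have h3 : r ∉ f u := fun hc =>
    hrf (Finset.mem_biUnion.2 ⟨u, Finset.mem_filter.2 ⟨hu, huM⟩, hc⟩)
  have h4 : r ∉ ({u i + L, u i - L - 1, -u i - L - 1, -u i + L} : Finset ℤ) := fun hc =>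
    h3 (Finset.mem_biUnion.2 ⟨i, Finset.mem_univ i, hc⟩)
  simpa using h4

end Radii

/-! ### Four colors from two parities -/

section ParityColoring

variable {d : ℕ}

/-- The points of `M` whose boxes contain `x`, where the box of `u ∈ M` has a radius that depends
on `M` seen from `u`. -/
def covers (ρ : Set (Site d) → ℤ) (M : Set (Site d)) (x : Site d) : Set (Site d) :=
  {u | u ∈ M ∧ x - u ∈ box d (ρ {w | u + w ∈ M})}

/-- The sum of the coordinates. -/
def coordSum (v : Site d) : ℤ := ∑ i, v i

/-- The parity of the origin relative to the boxes that contain it. -/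
noncomputable def parity (ρ : Set (Site d) → ℤ) (M : Set (Site d)) : ZMod 2 :=
  (sInf (coordSum '' covers ρ M 0) : ℤ)

theorem coordSum_add (v w : Site d) : coordSum (v + w) = coordSum v + coordSum w := by
  simp [coordSum, Finset.sum_add_distrib]

theorem coordSum_cast_of_norm1_eq_one {e : Site d} (he : norm1 e = 1) :
    (coordSum e : ZMod 2) = 1 := by
  obtain ⟨i, hi, hj⟩ := exists_single_of_norm1_eq_one he
  rw [coordSum, Finset.sum_eq_single i (fun j _ h => hj j h) (by simp)]
  rcases hi with h | h <;> rw [h] <;> decide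

theorem covers_shift (ρ : Set (Site d) → ℤ) (M : Set (Site d)) (e u : Site d) :
    u ∈ covers ρ {w | e + w ∈ M} 0 ↔ e + u ∈ covers ρ M e := by
  simp only [covers, Set.mem_ofPred_eq, zero_sub, sub_add_cancel_left, add_assoc]

variable {ρ : Set (Site d) → ℤ} {L : ℤ}

theorem covers_zero_subset_box (hρ : ∀ M, ρ M ≤ 2 * L) (M : Set (Site d)) :
    covers ρ M 0 ⊆ box d (2 * L) := by
  rintro u ⟨_, hu⟩
  rw [Finset.mem_coe, mem_box]
  intro i
  have h1 := mem_box.1 hu i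
  have h2 := hρ {w | u + w ∈ M}
  simp only [zero_sub, Pi.neg_apply] at h1
  omega

theorem exists_isLeast_coordSum_covers (hL : 0 ≤ L) (hρ : ∀ M, L ≤ ρ M ∧ ρ M ≤ 2 * L)
    {M : Set (Site d)} (hM : IsNet (boxNeighbors d L) M) :
    ∃ m, IsLeast (coordSum '' covers ρ M 0) m := by
  have hfin : (covers ρ M 0).Finite :=
    (box d (2 * L)).finite_toSet.subset (covers_zero_subset_box (fun M => (hρ M).2) M)
  have hne : (covers ρ M 0).Nonempty := by
    obtain ⟨u, hu, h⟩ := hM.exists_sub_mem_box hL 0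
    refine ⟨u, hu, mem_box.2 fun i => ?_⟩
    have h1 := mem_box.1 h i
    have h2 := hρ {w | u + w ∈ M}
    omega
  obtain ⟨u, hu, h⟩ := hfin.exists_minimalFor coordSum _ hne
  refine ⟨coordSum u, ⟨u, hu, rfl⟩, ?_⟩
  rintro _ ⟨v, hv, rfl⟩
  rcases le_total (coordSum u) (coordSum v) with hle | hle
  · exact hle
  · exact h hv hle

/-- Seen from the other end of an uncut edge, the same centers have all their coordinate sums
shifted by `coordSum e`, which is odd. So the minimum changes parity. -/
theorem parity_ne_of_covers_eq (hL : 0 ≤ L) (hρ : ∀ M, L ≤ ρ M ∧ ρ M ≤ 2 * L)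
    {M : Set (Site d)} (hM : IsNet (boxNeighbors d L) M) {e : Site d} (he : norm1 e = 1)
    (h : covers ρ M 0 = covers ρ M e) : parity ρ M ≠ parity ρ {w | e + w ∈ M} := by
  obtain ⟨m, hm⟩ := exists_isLeast_coordSum_covers hL hρ hM
  have hm' : IsLeast (coordSum '' covers ρ {w | e + w ∈ M} 0) (m - coordSum e) := by
    constructor
    · obtain ⟨u, hu, rfl⟩ := hm.1
      refine ⟨u - e, (covers_shift ρ M e _).2 ?_, ?_⟩
      · rwa [add_sub_cancel, ← h]
      · rw [eq_sub_iff_add_eq, ← coordSum_add, sub_add_cancel]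
    · rintro _ ⟨u, hu, rfl⟩
      rw [covers_shift, ← h] at hu
      have := hm.2 ⟨_, hu, rfl⟩
      rw [coordSum_add] at this
      omega
  rw [parity, parity, hm.csInf_eq, hm'.csInf_eq]
  push_cast
  rw [coordSum_cast_of_norm1_eq_one he]
  generalize (m : ZMod 2) = a
  revert a
  decide

/-- Relevant centers lie within `2 * L`, and their radii depend on a further `3 * L + 1`. -/
theorem parity_congr (hρ : ∀ M, ρ M ≤ 2 * L)
    (hloc : ∀ M M' : Set (Site d), (∀ u ∈ box d (3 * L + 1), u ∈ M ↔ u ∈ M') → ρ M = ρ M')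
    {M M' : Set (Site d)} (h : ∀ u ∈ box d (5 * L + 1), u ∈ M ↔ u ∈ M') :
    parity ρ M = parity ρ M' := by
  have : covers ρ M 0 = covers ρ M' 0 := by
    ext u
    by_cases hu : u ∈ box d (2 * L)
    · have h1 : u ∈ M ↔ u ∈ M' := h u (mem_box.2 fun i => by
        have := mem_box.1 hu i
        omega)
      have h2 : ρ {w | u + w ∈ M} = ρ {w | u + w ∈ M'} := hloc _ _ fun w hw =>
        h (u + w) (mem_box.2 fun i => by
          have := mem_box.1 hu i
          have := mem_box.1 hw i
          simp only [Pi.add_apply]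
          omega)
      simp only [covers, Set.mem_ofPred_eq, h1, h2]
    · exact ⟨fun hc => (hu (covers_zero_subset_box hρ M hc)).elim,
        fun hc => (hu (covers_zero_subset_box hρ M' hc)).elim⟩
  rw [parity, parity, this]

/-- No edge is cut both by the boxes of radius `L` and by the boxes of good radius. -/
theorem covers_eq_or_covers_eq (hL : (6 ^ d * (d * 4) : ℕ) ≤ L) {M : Set (Site d)}
    (hM : IsNet (boxNeighbors d L) M) {e : Site d} (he : norm1 e = 1) :
    covers (fun _ => L) M 0 = covers (fun _ => L) M e ∨
      covers (goodRadius L) M 0 = covers (goodRadius L) M e := by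
  have hL0 : 0 ≤ L := le_trans (Int.natCast_nonneg _) hL
  obtain ⟨i, hi, hj⟩ := exists_single_of_norm1_eq_one he
  by_contra! hc
  obtain ⟨h1, h2⟩ := hc
  have key : ∀ ρ : Set (Site d) → ℤ, covers ρ M 0 ≠ covers ρ M e →
      ∃ u ∈ M, ¬ (-u ∈ box d (ρ {w | u + w ∈ M}) ↔ -u + e ∈ box d (ρ {w | u + w ∈ M})) := by
    intro ρ hne
    by_contra! hcon
    refine hne (Set.ext fun u => ?_)
    simp only [covers, Set.mem_ofPred_eq, zero_sub]
    refine and_congr_right fun hu => ?_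
    rw [hcon u hu, neg_add_eq_sub]
  obtain ⟨u, huM, hu⟩ := key _ h1
  obtain ⟨v, hvM, hv⟩ := key _ h2
  have hgood := isGoodRadius_goodRadius ((hM.shift v).exists_isGoodRadius hL)
  set r := goodRadius L {w | v + w ∈ M} with hr
  obtain ⟨hr1, hr2, hr3⟩ := hgood
  have hbu := boundary_of_not_mem_box_iff hi hj hu
  have hbv := boundary_of_not_mem_box_iff hi hj hv
  -- Both boxes meet the same edge: radii `L` and at most `2 * L`, plus 1 for the edge.
  have hmem : u - v ∈ box d (3 * L + 1) := by
    refine mem_box.2 fun j => ?_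
    have ej : -1 ≤ e j ∧ e j ≤ 1 := by
      by_cases hji : j = i
      · subst hji; omega
      · rw [hj j hji]; omega
    have hu' : (-L ≤ -u j ∧ -u j ≤ L) ∨ (-L ≤ -u j + e j ∧ -u j + e j ≤ L) := by
      by_cases h : -u ∈ box d L
      · left; simpa using mem_box.1 h j
      · right
        have h' : -u + e ∈ box d L := by by_contra h'; exact hu (iff_of_false h h')
        simpa using mem_box.1 h' j
    have hv' : (-r ≤ -v j ∧ -v j ≤ r) ∨ (-r ≤ -v j + e j ∧ -v j + e j ≤ r) := by
      by_cases h : -v ∈ box d r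
      · left; simpa using mem_box.1 h j
      · right
        have h' : -v + e ∈ box d r := by by_contra h'; exact hv (iff_of_false h h')
        simpa using mem_box.1 h' j
    simp only [Pi.sub_apply]
    omega
  -- Both boxes have a face crossing the same edge, so their faces agree in coordinate `i`; these
  -- are the four coincidences that a good radius excludes.
  have := hr3 (u - v) hmem (by simpa using huM) i
  simp only [Pi.neg_apply, Pi.sub_apply] at hbu hbv this
  omega

/-- In every dimension there is a local rule that turns nets into proper 4-colorings. -/
theorem exists_four_coloring_rule (d q : ℕ) (hq : 4 ≤ q) :
    ∃ (D S : Finset (Site d)) (G : Set (Site d) → Fin q), 0 ∉ D ∧ (∀ w ∈ D, -w ∈ D) ∧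
      (∀ M M' : Set (Site d), (∀ u ∈ S, u ∈ M ↔ u ∈ M') → G M = G M') ∧
      ∀ M, IsNet D M → ∀ e, norm1 e = 1 → G M ≠ G {u | e + u ∈ M} := by
  obtain ⟨L, hL⟩ : ∃ L : ℤ, (6 ^ d * (d * 4) : ℕ) ≤ L := ⟨_, le_rfl⟩
  have hL0 : 0 ≤ L := le_trans (Int.natCast_nonneg _) hL
  have hconst : ∀ M : Set (Site d), L ≤ (fun _ => L) M ∧ (fun _ : Set (Site d) => L) M ≤ 2 * L :=
    fun M => by constructor <;> simp only <;> omega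
  obtain ⟨ψ⟩ : Nonempty (ZMod 2 × ZMod 2 ↪ Fin q) := by
    rw [Function.Embedding.nonempty_iff_card_le]
    simpa [ZMod.card] using hq
  refine ⟨boxNeighbors d L, box d (5 * L + 1),
    fun M => ψ (parity (fun _ => L) M, parity (goodRadius L) M), by simp [boxNeighbors], ?_, ?_, ?_⟩
  · intro w hw
    rw [boxNeighbors, Finset.mem_erase, mem_box] at hw ⊢
    refine ⟨neg_ne_zero.2 hw.1, fun i => ?_⟩
    have := hw.2 i
    simp only [Pi.neg_apply]
    omega
  · intro M M' h
    simp only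
    rw [parity_congr (fun M => (hconst M).2) (fun _ _ _ => rfl) h,
      parity_congr (fun M => (goodRadius_mem hL0 M).2) (fun _ _ => goodRadius_congr) h]
  · intro M hM e he hc
    have hc' := ψ.injective hc
    rw [Prod.mk.injEq] at hc'
    rcases covers_eq_or_covers_eq hL hM he with h | h
    · exact parity_ne_of_covers_eq hL0 hconst hM he h hc'.1
    · exact parity_ne_of_covers_eq hL0 (goodRadius_mem hL0) hM he h hc'.2

end ParityColoring

/-! ### Three colors on the line -/

section Line

/-- On the line there is a local rule that turns nets into proper 3-colorings. -/
theorem exists_three_coloring_rule (q : ℕ) (hq : 3 ≤ q) :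
    ∃ (D S : Finset (Site 1)) (G : Set (Site 1) → Fin q), 0 ∉ D ∧ (∀ w ∈ D, -w ∈ D) ∧
      (∀ M M' : Set (Site 1), (∀ u ∈ S, u ∈ M ↔ u ∈ M') → G M = G M') ∧
      ∀ M, IsNet D M → ∀ e, norm1 e = 1 → G M ≠ G {u | e + u ∈ M} := by
  classical
  set a : Site 1 := fun _ => 1 with ha
  have ha0 : a ≠ 0 := fun h => by simpa [ha] using congrFun h 0
  -- Consecutive net points are at distance 2 or 3, so the colors read 2, 0 or 2, 0, 1 from each net
  -- point to the next.
  let G : Set (Site 1) → Fin q := fun M =>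
    if (0 : Site 1) ∈ M then ⟨2, by omega⟩ else if -a ∈ M then ⟨0, by omega⟩ else ⟨1, by omega⟩
  have key : ∀ M, IsNet ({a, -a} : Finset (Site 1)) M → G M ≠ G {u | a + u ∈ M} := by
    intro M hM
    have h1 : (0 : Site 1) ∈ M → a ∉ M := fun h => by simpa using hM.sep h a (by simp)
    have h2 : -a ∈ M → (0 : Site 1) ∉ M := fun h => by simpa using hM.sep h a (by simp)
    have h3 : (0 : Site 1) ∉ M → a ∈ M ∨ -a ∈ M := fun h => by
      obtain ⟨w, hw, h'⟩ := hM.dom h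
      simp only [Finset.mem_insert, Finset.mem_singleton] at hw
      rcases hw with rfl | rfl
      · left; simpa using h'
      · right; simpa using h'
    simp only [G, Set.mem_ofPred_eq, add_zero, add_neg_cancel]
    split_ifs <;> simp_all
  refine ⟨{a, -a}, {0, -a}, G, by simp [ha0.symm, eq_comm, ha0], ?_, ?_, ?_⟩
  · intro w hw
    simp only [Finset.mem_insert, Finset.mem_singleton] at hw ⊢
    rcases hw with rfl | rfl <;> simp
  · intro M M' h
    simp only [G, h 0 (by simp), h (-a) (by simp)]
  · intro M hM e he
    obtain ⟨i, hi, -⟩ := exists_single_of_norm1_eq_one he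
    rcases hi with hi | hi
    · have : e = a := by
        funext j
        rw [Subsingleton.elim j i, hi]
      rw [this]
      exact key M hM
    · have : e = -a := by
        funext j
        rw [Subsingleton.elim j i, hi]; rfl
      -- The step to the left is a step to the right for the shifted net.
      have h := key _ (hM.shift e)
      simp only [this, Set.mem_ofPred_eq, neg_add_cancel_left] at h ⊢
      exact h.symm

end Line

end FinitaryColoring

theorem theorem1 (d q : ℕ) (hdq : (d = 1 ∧ 3 ≤ q) ∨ (2 ≤ d ∧ 4 ≤ q)) :
    ∃ c C : ℝ, 0 < c ∧ 0 < C ∧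
      (∃ (Ω : Type) (_ : MeasurableSpace Ω) (P : Measure Ω) (_ : IsProbabilityMeasure P)
        (Y : Site d → Ω → ℝ) (F : (Site d → ℝ) → (Site d → Fin q)) (X : Ω → Site d → Fin q),
        IsFFIID P Y F X ∧ IsColoring P X ∧
        ∀ r : ℝ, 0 ≤ r →
          radiusTail P Y F r ≤ 1 / towerReal (c * r) ∧
          (1 ≤ c * r → radiusTail P Y F r < 1 / towerReal (c * r))) ∧
      (∀ (Ω : Type u) [MeasurableSpace Ω] (P : Measure Ω) [IsProbabilityMeasure P]
        (B : Type v) [MeasurableSpace B]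
        (Y : Site d → Ω → B) (F : (Site d → B) → (Site d → Fin q)) (X : Ω → Site d → Fin q),
        IsFFIID P Y F X → IsColoring P X →
        ∀ r : ℝ, 0 ≤ r →
          1 / towerReal (C * r) ≤ radiusTail P Y F r ∧
          (1 ≤ C * r → 1 / towerReal (C * r) < radiusTail P Y F r)) := by
  obtain ⟨C, hC, hlower⟩ := exists_le_radiusTail.{u, v} d q (by omega)
  obtain ⟨D, S, G, h0, hsymm, hG, hproper⟩ : ∃ (D S : Finset (Site d)) (G : Set (Site d) → Fin q),
      0 ∉ D ∧ (∀ w ∈ D, -w ∈ D) ∧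
      (∀ M M' : Set (Site d), (∀ u ∈ S, u ∈ M ↔ u ∈ M') → G M = G M') ∧
      ∀ M, IsNet D M → ∀ e, norm1 e = 1 → G M ≠ G {u | e + u ∈ M} := by
    rcases hdq with ⟨rfl, hq⟩ | ⟨_, hq⟩
    · exact exists_three_coloring_rule q hq
    · exact exists_four_coloring_rule d q hq
  obtain ⟨c, hc, hupper⟩ := exists_radiusTail_le h0 hsymm hG hproper
  exact ⟨c, C, hc, hC, hupper, hlower⟩
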